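/- For a random variable $X$ and $\alpha\in\{1,2\}$ let $\|X\|_{\psi_\alpha}=\inf\{c>0:\ \mathbb E\,(\exp((|X|/c)^\alpha)-1)\le 1\}$. For every $K\ge 0$ there is a constant $C>0$, depending only on $K$, such that the following holds. Let $Z$ be a centered, symmetric real random variable with unit variance and $\|Z\|_{\psi_2}\le K$. Let $f$ be a (possibly random) measurable link function, i.e. $f(t)=f(t,\xi)$ where $\xi$ is a random element independent of the sampling vectors. For $k\ge 1$ let $Z_1,\dots,Z_k$ be independent copies of $Z$ (independent of $\xi$), $\bar Z_k=\frac1k\sum_{i\le k}Z_i$, $\mathbf r_{k,Z}=(Z_1-\bar Z_k,\dots,Z_k-\bar Z_k)$, and put $$\mu(f,Z,k)=\mathrm{Cov}\big((\sqrt k\,\bar Z_k)^2,\ f(\sqrt k\,\bar Z_k)\big),\qquad \sigma(f,Z,k)=\mathrm{Cov}\big(\|\mathbf r_{k,Z}\|_2^2,\ f(\sqrt k\,\bar Z_k)\big).$$ Let $\mathbf x_*\in\mathbb R^n$ be a unit vector that is admissible for the sparsity parameter $s$: there is $I\subset\{1,\dots,n\}$ with $k:=|I|\le s$ such that $(\mathbf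 x_*)_j=\pm 1/\sqrt{k}$ for $j\in I$ and $(\mathbf x_*)_j=0$ otherwise. Assume $$\mu:=\mu(f,Z,k)>0,\qquad \sigma(f,Z,k)\le 0,\qquad \|f(\sqrt k\,\bar Z_k)\|_{\psi_1}\le K .$$ Let $\mathbf a_1,\dots,\mathbf a_m$ be independent random vectors in $\mathbb R^n$ whose coordinates are independent copies of $Z$, and let $y_i=f(\langle \mathbf a_i,\mathbf x_*\rangle)$, with an independent copy $\xi_i$ of the randomness of $f$ for each $i$. The algorithm forms $\hat{\boldsymbol\Sigma}=\frac1m\sum_{i=1}^m y_i(\mathbf a_i\mathbf a_i^T-\mathbf I_n)$, takes a solution $\hat{\mathbf X}$ of $$\max_{\mathbf X\succeq 0}\ \langle \mathbf X,\hat{\boldsymbol\Sigma}\rangle\quad\text{subject to}\quad \mathrm{Tr}(\mathbf X)=1,\ \ \sum_{i,j}|\mathbf X_{ij}|\le s,$$ and outputs a unit leading eigenvector $\hat{\mathbf x}$ of $\hat{\mathbf X}$. Then for all $\epsilon,\delta>0$, if $$m\ \ge\ \frac{C s^2\big(\log(n/\delta)+\log^4(s/\delta)\big)}{\mu^2\epsilon^4}+\frac{Cs}{\delta}+C\log(n/\delta)\,\log^2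 m,$$ then with probability at least $1-\delta$ the algorithm has an output, and every output $\hat{\mathbf x}$ satisfies $\min\{\|\hat{\mathbf x}-\mathbf x_*\|_2,\ \|\hat{\mathbf x}+\mathbf x_*\|_2\}\le\epsilon$. -/

import Mathlib

open MeasureTheory ProbabilityTheory
open scoped ENNReal NNReal Matrix

namespace SparsePR

noncomputable section

/-- The Orlicz norm `‖X‖_{ψ_α}`, for `ψ_α x = exp (x ^ α) - 1` with `α ≥ 1`: the infimum of the
`c > 0` with `𝔼 ψ_α(|X| / c) ≤ 1`, with value `∞` if there is no such `c`. -/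
def psiNorm {Ω : Type*} [MeasurableSpace Ω] (α : ℝ) (X : Ω → ℝ) (P : Measure Ω) : ℝ≥0∞ :=
  ⨅ (c : ℝ≥0) (_ : 0 < c ∧
    ∫⁻ ω, ENNReal.ofReal (Real.exp ((|X ω| / (c : ℝ)) ^ α) - 1) ∂P ≤ 1), (c : ℝ≥0∞)

/-- `ζ` is the law of a random variable `Z` that is centered, symmetric, of unit variance and
with subgaussian norm at most `K`. -/
structure IsCoordinateLaw (ζ : Measure ℝ) (K : ℝ≥0) : Prop where
  isProbabilityMeasure : IsProbabilityMeasure ζ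
  centered : ∫ z, z ∂ζ = 0
  symmetric : ζ.map (fun z => -z) = ζ
  unit_variance : variance (fun z : ℝ => z) ζ = 1
  subgaussian : psiNorm 2 (fun z : ℝ => z) ζ ≤ K

/-- The mean of `z 1, …, z k`. -/
def mean {k : ℕ} (z : Fin k → ℝ) : ℝ := (∑ i, z i) / k

/-- The squared Euclidean norm of the vector of residuals `(z i - mean z)_i`. -/
def residualSq {k : ℕ} (z : Fin k → ℝ) : ℝ := ∑ i, (z i - mean z) ^ 2

/-- The random variable `√k Z̄_k`, on the space of `k` independent copies of `Z` together with the
randomness of the link function. -/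
def scaledMean {E : Type*} (k : ℕ) (p : (Fin k → ℝ) × E) : ℝ := √(k : ℝ) * mean p.1

/-- The joint law of `k` independent copies of `Z` and of the (independent) randomness of the link
function. -/
def copiesLaw {E : Type*} [MeasurableSpace E] (ζ : Measure ℝ) (η : Measure E) (k : ℕ) :
    Measure ((Fin k → ℝ) × E) :=
  (Measure.pi fun _ : Fin k => ζ).prod η

/-- The random variable `f(√k Z̄_k)`. -/
def linkValue {E : Type*} (f : ℝ → E → ℝ) (k : ℕ) (p : (Fin k → ℝ) × E) : ℝ :=
  f (scaledMean k p) p.2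

/-- `μ(f, Z, k) = Cov((√k Z̄_k)², f(√k Z̄_k))`. -/
def muCov {E : Type*} [MeasurableSpace E] (f : ℝ → E → ℝ) (ζ : Measure ℝ) (η : Measure E)
    (k : ℕ) : ℝ :=
  covariance (fun p => scaledMean k p ^ 2) (linkValue f k) (copiesLaw ζ η k)

/-- `σ(f, Z, k) = Cov(‖r_{k,Z}‖², f(√k Z̄_k))`. -/
def sigmaCov {E : Type*} [MeasurableSpace E] (f : ℝ → E → ℝ) (ζ : Measure ℝ) (η : Measure E)
    (k : ℕ) : ℝ :=
  covariance (fun p => residualSq p.1) (linkValue f k) (copiesLaw ζ η k)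

/-- `x` is a unit vector whose entries are `±1/√|I|` on an index set `I` with `|I| ≤ s`, and zero
elsewhere. -/
def IsAdmissible {n : ℕ} (s : ℕ) (x : EuclideanSpace ℝ (Fin n)) : Prop :=
  ‖x‖ = 1 ∧ ∃ I : Finset (Fin n), I.card ≤ s ∧
    (∀ j ∈ I, x j = 1 / √(I.card : ℝ) ∨ x j = -(1 / √(I.card : ℝ))) ∧ ∀ j ∉ I, x j = 0

/-- The number of nonzero entries of `x`. -/
def supportSize {n : ℕ} (x : EuclideanSpace ℝ (Fin n)) : ℕ :=
  (Finset.univ.filter fun j => x j ≠ 0).card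

/-- The pairs `(a_i, ξ_i)` are independent; in each of them the coordinates of `a_i` are
independent copies of `Z`, and the randomness `ξ_i` of the link function has law `η` and is
independent of `a_i`. -/
structure IsSample {Ω E : Type*} [MeasurableSpace Ω] [MeasurableSpace E] {m n : ℕ}
    (a : Fin m → Ω → Fin n → ℝ) (ξ : Fin m → Ω → E) (ζ : Measure ℝ) (η : Measure E)
    (P : Measure Ω) : Prop where
  law : ∀ i, HasLaw (fun ω => (a i ω, ξ i ω)) ((Measure.pi fun _ : Fin n => ζ).prod η) P
  indep : iIndepFun (fun i ω => (a i ω, ξ i ω)) P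

/-- The measurement `f(⟨a, x⟩)`, where `e` is the randomness of the link function. -/
def measurement {E : Type*} {n : ℕ} (f : ℝ → E → ℝ) (x : EuclideanSpace ℝ (Fin n))
    (a : Fin n → ℝ) (e : E) : ℝ :=
  f (∑ j, a j * x j) e

/-- The reweighted sample covariance matrix `(1/m) ∑ y_i (a_i a_iᵀ - 1)`. -/
def sampleMatrix {m n : ℕ} (a : Fin m → Fin n → ℝ) (y : Fin m → ℝ) : Matrix (Fin n) (Fin n) ℝ :=
  (1 / (m : ℝ)) • ∑ i, y i • (Matrix.vecMulVec (a i) (a i) - 1)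

/-- The feasible set of the semidefinite program: positive semidefinite matrices of unit trace
whose entrywise `ℓ₁` norm is at most `s`. -/
def feasibleSet (n s : ℕ) : Set (Matrix (Fin n) (Fin n) ℝ) :=
  {X | X.PosSemidef ∧ X.trace = 1 ∧ ∑ i, ∑ j, |X i j| ≤ (s : ℝ)}

/-- `X` maximizes `⟨X, S⟩ = Tr(Xᵀ S)` over the feasible set. -/
def IsSDPSolution {n : ℕ} (s : ℕ) (S X : Matrix (Fin n) (Fin n) ℝ) : Prop :=
  X ∈ feasibleSet n s ∧ IsMaxOn (fun Y => (Yᵀ * S).trace) (feasibleSet n s) X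

/-- `v` is a unit eigenvector of `X` for the largest eigenvalue of `X`. -/
def IsLeadingEigenvector {n : ℕ} (X : Matrix (Fin n) (Fin n) ℝ) (v : EuclideanSpace ℝ (Fin n)) :
    Prop :=
  ‖v‖ = 1 ∧ ∃ t : ℝ, IsGreatest {r : ℝ | Module.End.HasEigenvalue (Matrix.toLin' X) r} t ∧
    X *ᵥ v.ofLp = t • v.ofLp

/-- `v` is a possible output of Sparse PCA for misspecified phase retrieval, on input
`a_1, …, a_m`, `y_1, …, y_m` and `s`: a leading eigenvector of a solution of the program. -/
def IsOutput {m n : ℕ} (s : ℕ) (a : Fin m → Fin n → ℝ) (y : Fin m → ℝ)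
    (v : EuclideanSpace ℝ (Fin n)) : Prop :=
  ∃ X, IsSDPSolution s (sampleMatrix a y) X ∧ IsLeadingEigenvector X v

/-- The algorithm has an output, and each of its outputs is within `ε` of `x` or of `-x`. -/
def Recovers {m n : ℕ} (s : ℕ) (a : Fin m → Fin n → ℝ) (y : Fin m → ℝ)
    (x : EuclideanSpace ℝ (Fin n)) (ε : ℝ) : Prop :=
  (∃ v, IsOutput s a y v) ∧ ∀ v, IsOutput s a y v → ‖v - x‖ ≤ ε ∨ ‖v + x‖ ≤ ε

end

end SparsePR

namespace SparsePR

/-! ### The semidefinite program -/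

section Program

variable {n : ℕ}

/-! The argument splits into a deterministic statement about the program and entrywise concentration
of the sample matrix around its mean `M = crossCov`, whose entries are Cov(a_j a_l, y).

Mean. A coordinate outside the support does not affect y, so resampling it or flipping its sign
shows that its row of `M` vanishes. On the support, exchangeability leaves only two covariances, β
off the diagonal and γ on it, so that M = kβ xxᵀ + (γ-β) D with D the coordinate projection onto the
support. Expanding squares gives μ = kβ + (γ-β) and σ = (k-1)(γ-β), so σ ≤ 0 means γ ≤ β (for k = 1
one takes γ = β). For X ⪰ 0 the form xᵀXx is at most the trace of X over the support, hence ⟨X, M⟩ ≤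
μ xᵀXx, with value μ at X = xxᵀ (`crossCov_quadraticForm`).

Program. The matrix xxᵀ is feasible because ‖x‖₁² = k ≤ s. If all entries of the sample matrix are
within με²/(8s) of `M`, the ℓ₁ constraint makes the objective accurate to με²/8 on the feasible set,
so a maximizer has xᵀXx ≥ 1 - ε²/4. Deflating its top eigenvector shows that this vector is within ε
of ±x (`recovers_of_entrywise_close`).

Concentration. The summands y(a_j a_l - δ_jl) need not have exponential moments, so each is paired
with a random variance proxy H satisfying E exp(λG - λ²H) ≤ 1 (`exists_entry_control`). Inside the
support two moments suffice; with one index outside, the outer coordinate is subgaussian given the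
rest; with both outside, y is independent of the product but must be truncated at a level B of order
log m. A Chernoff bound then applies on the event that all |y_i| ≤ B and the sums of H are O(m).
Markov's and Chebyshev's inequalities control that event, the latter only for the k + 1 sums of y²
and of y² a_j⁴ with j in the support; this costs m of order s/δ rather than n/δ. A union bound over
the n² entries, with the exponent chosen in `exists_exponent`, concludes. -/

lemma trace_transpose_mul_eq_sum (X S : Matrix (Fin n) (Fin n) ℝ) :
    (Xᵀ * S).trace = ∑ i, ∑ j, X i j * S i j := by
  simp only [Matrix.trace, Matrix.diag, Matrix.mul_apply, Matrix.transpose_apply]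
  exact Finset.sum_comm

lemma sum_sq_eq_norm_sq (v : EuclideanSpace ℝ (Fin n)) : ∑ j, v j ^ 2 = ‖v‖ ^ 2 := by
  rw [EuclideanSpace.real_norm_sq_eq]

lemma isClosed_posSemidef : IsClosed {X : Matrix (Fin n) (Fin n) ℝ | X.PosSemidef} := by
  have : {X : Matrix (Fin n) (Fin n) ℝ | X.PosSemidef} =
      {X | Xᴴ = X} ∩ ⋂ v : Fin n → ℝ, {X | 0 ≤ star v ⬝ᵥ X *ᵥ v} := by
    ext X
    simp only [Set.mem_ofPred_eq, Set.mem_inter_iff, Set.mem_iInter]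
    exact ⟨fun h => ⟨h.1, h.dotProduct_mulVec_nonneg⟩,
      fun h => Matrix.PosSemidef.of_dotProduct_mulVec_nonneg h.1 h.2⟩
  rw [this]
  refine (isClosed_eq (by fun_prop) continuous_id).inter (isClosed_iInter fun v => ?_)
  exact isClosed_le continuous_const (by fun_prop)

lemma isCompact_feasibleSet (s : ℕ) : IsCompact (feasibleSet n s) := by
  have hK : IsCompact (Set.univ.pi fun _ : Fin n => Set.univ.pi fun _ : Fin n =>
      Set.Icc (-(s : ℝ)) s) :=
    isCompact_univ_pi fun _ => isCompact_univ_pi fun _ => isCompact_Icc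
  refine IsCompact.of_isClosed_subset hK ?_ ?_
  · have h1 : IsClosed {X : Matrix (Fin n) (Fin n) ℝ | X.trace = 1} :=
      isClosed_eq (by fun_prop) continuous_const
    have h2 : IsClosed {X : Matrix (Fin n) (Fin n) ℝ | ∑ i, ∑ j, |X i j| ≤ (s : ℝ)} := by
      refine isClosed_le ?_ continuous_const
      refine continuous_finsetSum _ fun i _ => continuous_finsetSum _ fun j _ => ?_
      exact (continuous_id.matrix_elem i j).abs
    exact isClosed_posSemidef.inter (h1.inter h2)
  · rintro X ⟨-, -, h⟩ i - j -
    rw [Set.mem_Icc, ← abs_le]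
    calc |X i j| ≤ ∑ j, |X i j| :=
          Finset.single_le_sum (f := fun j => |X i j|) (fun _ _ => abs_nonneg _) (Finset.mem_univ j)
      _ ≤ ∑ i, ∑ j, |X i j| :=
          Finset.single_le_sum (f := fun i => ∑ j, |X i j|)
            (fun _ _ => Finset.sum_nonneg fun _ _ => abs_nonneg _) (Finset.mem_univ i)
      _ ≤ s := h

lemma exists_isSDPSolution {s : ℕ} (h : (feasibleSet n s).Nonempty)
    (S : Matrix (Fin n) (Fin n) ℝ) : ∃ X, IsSDPSolution s S X := by
  obtain ⟨X, hX, hmax⟩ := (isCompact_feasibleSet (n := n) s).exists_isMaxOn h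
    (f := fun Y => (Yᵀ * S).trace) (by fun_prop)
  exact ⟨X, hX, hmax⟩

/-! ### Leading eigenvectors and quadratic forms. -/

lemma hasEigenvalue_toLin'_iff {X : Matrix (Fin n) (Fin n) ℝ} (hX : X.IsHermitian) (r : ℝ) :
    Module.End.HasEigenvalue (Matrix.toLin' X) r ↔ r ∈ Set.range hX.eigenvalues := by
  rw [Module.End.hasEigenvalue_iff_mem_spectrum, Matrix.spectrum_toLin',
    hX.spectrum_real_eq_range_eigenvalues]

lemma exists_isLeadingEigenvector [NeZero n] {X : Matrix (Fin n) (Fin n) ℝ}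
    (hX : X.IsHermitian) : ∃ v, IsLeadingEigenvector X v := by
  obtain ⟨i, -, hi⟩ := Finset.exists_max_image Finset.univ hX.eigenvalues
    ⟨0, Finset.mem_univ _⟩
  refine ⟨hX.eigenvectorBasis i, hX.eigenvectorBasis.orthonormal.1 i, hX.eigenvalues i,
    ⟨?_, ?_⟩, hX.mulVec_eigenvectorBasis i⟩
  · exact (hasEigenvalue_toLin'_iff hX _).2 ⟨i, rfl⟩
  · intro r hr
    obtain ⟨j, rfl⟩ := (hasEigenvalue_toLin'_iff hX r).1 hr
    exact hi j (Finset.mem_univ j)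

/-- The Rayleigh bound. -/
lemma dotProduct_mulVec_le_of_eigenvalue_le {X : Matrix (Fin n) (Fin n) ℝ} (hX : X.IsHermitian)
    {t : ℝ} (ht : ∀ r, Module.End.HasEigenvalue (Matrix.toLin' X) r → r ≤ t)
    (u : Fin n → ℝ) : u ⬝ᵥ X *ᵥ u ≤ t * (u ⬝ᵥ u) := by
  have hH : (t • (1 : Matrix (Fin n) (Fin n) ℝ) - X).IsHermitian :=
    (by simp [Matrix.IsHermitian] : (t • (1 : Matrix (Fin n) (Fin n) ℝ)).IsHermitian).sub hX
  have hP : (t • (1 : Matrix (Fin n) (Fin n) ℝ) - X).PosSemidef := by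
    -- An eigenvalue e of t - X makes t - e an eigenvalue of X, so t - e ≤ t.
    rw [hH.posSemidef_iff_eigenvalues_nonneg]
    intro i
    have h1 := hH.mulVec_eigenvectorBasis i
    set w := (hH.eigenvectorBasis i).ofLp with hw
    set e := hH.eigenvalues i with he
    have hw0 : w ≠ 0 := by
      intro h
      have := hH.eigenvectorBasis.orthonormal.ne_zero i
      exact this (WithLp.ofLp_injective 2 h)
    have h2 : X *ᵥ w = (t - e) • w := by
      rw [Matrix.sub_mulVec, Matrix.smul_mulVec, Matrix.one_mulVec] at h1
      rw [sub_smul, ← h1]; abel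
    have h3 : Module.End.HasEigenvalue (Matrix.toLin' X) (t - e) :=
      Module.End.hasEigenvalue_of_hasEigenvector (x := w)
        ⟨Module.End.mem_eigenspace_iff.2 (by simpa using h2), hw0⟩
    have := ht _ h3
    change 0 ≤ e
    linarith
  have := hP.dotProduct_mulVec_nonneg u
  rw [Matrix.sub_mulVec, Matrix.smul_mulVec, Matrix.one_mulVec, dotProduct_sub,
    dotProduct_smul, star_trivial, smul_eq_mul] at this
  linarith

/-- A quadratic form is at most the trace, on unit vectors. -/
lemma dotProduct_mulVec_le_trace {Y : Matrix (Fin n) (Fin n) ℝ} (hY : Y.PosSemidef)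
    (u : Fin n → ℝ) : u ⬝ᵥ Y *ᵥ u ≤ Y.trace * (u ⬝ᵥ u) := by
  have hH := hY.isHermitian
  refine dotProduct_mulVec_le_of_eigenvalue_le hH (fun r hr => ?_) u
  obtain ⟨j, rfl⟩ := (hasEigenvalue_toLin'_iff hH _).1 hr
  rw [hH.trace_eq_sum_eigenvalues]
  exact Finset.single_le_sum (f := fun j => hH.eigenvalues j)
    (fun j _ => hY.eigenvalues_nonneg j) (Finset.mem_univ j)

/-- A leading eigenvector of a positive semidefinite matrix of unit trace is close to any unit
vector at which the quadratic form is close to one. -/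
lemma IsLeadingEigenvector.one_sub_sq_mul_le {X : Matrix (Fin n) (Fin n) ℝ} (hX : X.PosSemidef)
    (htr : X.trace = 1) {v x : EuclideanSpace ℝ (Fin n)} (hv : IsLeadingEigenvector X v)
    (hx : ‖x‖ = 1) {η : ℝ} (hη : 1 - η ≤ x.ofLp ⬝ᵥ X *ᵥ x.ofLp) :
    (1 - (v.ofLp ⬝ᵥ x.ofLp) ^ 2) * (1 - η) ≤ η := by
  obtain ⟨hv1, t, ht, hvt⟩ := hv
  have nv : v.ofLp ⬝ᵥ v.ofLp = 1 := by
    have := sum_sq_eq_norm_sq v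
    rw [hv1] at this
    simpa [dotProduct, sq] using this
  have nx : x.ofLp ⬝ᵥ x.ofLp = 1 := by
    have := sum_sq_eq_norm_sq x
    rw [hx] at this
    simpa [dotProduct, sq] using this
  set V := v.ofLp
  set U := x.ofLp
  set c := V ⬝ᵥ U with hc
  have hUV : U ⬝ᵥ V = c := dotProduct_comm _ _
  have hq : U ⬝ᵥ X *ᵥ U ≤ t := by
    have := dotProduct_mulVec_le_of_eigenvalue_le hX.isHermitian (fun r hr => ht.2 hr) U
    rwa [nx, mul_one] at this
  have hXs : ∀ a b : Fin n → ℝ, a ⬝ᵥ X *ᵥ b = b ⬝ᵥ X *ᵥ a := by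
    intro a b
    have hT : Xᵀ = X := by simpa [Matrix.IsHermitian] using hX.isHermitian
    rw [Matrix.dotProduct_mulVec, ← Matrix.mulVec_transpose, hT, dotProduct_comm]
  -- Deflation: the form of Y at u is that of X at the component of u orthogonal to V, so Y is
  -- positive semidefinite, and its trace is 1 - t.
  set Y := X - t • Matrix.vecMulVec V V with hY
  have hYm : ∀ u : Fin n → ℝ, Y *ᵥ u = X *ᵥ u - (t * (V ⬝ᵥ u)) • V := by
    intro u
    rw [hY, Matrix.sub_mulVec, Matrix.smul_mulVec, Matrix.vecMulVec_mulVec, mul_smul]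
    simp
  have hYP : Y.PosSemidef := by
    refine Matrix.PosSemidef.of_dotProduct_mulVec_nonneg ?_ fun u => ?_
    · refine hX.isHermitian.sub ?_
      ext i j
      simp [Matrix.vecMulVec_apply, mul_comm]
    · have h := hX.dotProduct_mulVec_nonneg (u - (V ⬝ᵥ u) • V)
      simp only [star_trivial, Matrix.mulVec_sub, Matrix.mulVec_smul, hvt, dotProduct_sub,
        sub_dotProduct, smul_dotProduct, dotProduct_smul, smul_eq_mul, hXs V u, nv] at h
      rw [hYm]
      simp only [star_trivial, dotProduct_sub, dotProduct_smul, smul_eq_mul,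
        dotProduct_comm u V] at h ⊢
      nlinarith
  have hYtr : Y.trace = 1 - t := by
    rw [hY, Matrix.trace_sub, htr, Matrix.trace_smul, Matrix.trace_vecMulVec, nv]
    simp
  have ht1 : t ≤ 1 := by
    have := hYP.trace_nonneg
    rw [hYtr] at this
    linarith
  -- The component of U orthogonal to V has squared norm 1 - c², and Y is at most its trace 1 - t
  -- there. This yields `key`, where t ≤ 1 and t ≥ 1 - η finish the proof.
  have hw := dotProduct_mulVec_le_trace hYP (U - c • V)
  rw [hYtr] at hw
  simp only [hYm, dotProduct_sub, sub_dotProduct, smul_dotProduct, dotProduct_smul, smul_eq_mul,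
    nv, nx, hUV, ← hc, Matrix.mulVec_sub, Matrix.mulVec_smul, hvt, hXs V U] at hw
  have hc1 : 0 ≤ 1 - c ^ 2 := by
    have h0 : 0 ≤ (U - c • V) ⬝ᵥ (U - c • V) := by
      have := dotProduct_star_self_nonneg (U - c • V)
      simpa using this
    simp only [dotProduct_sub, sub_dotProduct, smul_dotProduct, dotProduct_smul, smul_eq_mul,
      nv, nx, hUV, ← hc] at h0
    nlinarith
  have key : U ⬝ᵥ X *ᵥ U ≤ c ^ 2 * t + (1 - c ^ 2) * (1 - t) := by nlinarith
  nlinarith [mul_nonneg hc1 (by linarith : (0 : ℝ) ≤ t - (1 - η)), sq_nonneg c]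

/-! ### From the quadratic form to recovery. -/

lemma norm_sub_sq_of_unit {v x : EuclideanSpace ℝ (Fin n)} (hv : ‖v‖ = 1) (hx : ‖x‖ = 1) :
    ‖v - x‖ ^ 2 = 2 - 2 * (v.ofLp ⬝ᵥ x.ofLp) ∧ ‖v + x‖ ^ 2 = 2 + 2 * (v.ofLp ⬝ᵥ x.ofLp) := by
  have h : inner ℝ v x = v.ofLp ⬝ᵥ x.ofLp := by
    rw [EuclideanSpace.inner_eq_star_dotProduct, star_trivial, dotProduct_comm]
  rw [norm_sub_sq_real, norm_add_sq_real, hv, hx, h]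
  constructor <;> ring

/-- With c = ⟨v, x⟩ the squared distances are 2 ∓ 2c, and 1 - |c| ≤ 1 - c² because |c| ≤ 1. The sign
of c decides the alternative. -/
lemma close_of_le_sq {v x : EuclideanSpace ℝ (Fin n)} (hv : ‖v‖ = 1) (hx : ‖x‖ = 1) {ε : ℝ}
    (hε : 0 ≤ ε) (h : 2 * (1 - (v.ofLp ⬝ᵥ x.ofLp) ^ 2) ≤ ε ^ 2) :
    ‖v - x‖ ≤ ε ∨ ‖v + x‖ ≤ ε := by
  obtain ⟨h1, h2⟩ := norm_sub_sq_of_unit hv hx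
  have h3 := sq_nonneg ‖v - x‖
  have h4 := sq_nonneg ‖v + x‖
  rcases le_total 0 (v.ofLp ⬝ᵥ x.ofLp) with hc | hc
  · left
    refine abs_le_of_sq_le_sq' ?_ hε |>.2
    nlinarith
  · right
    refine abs_le_of_sq_le_sq' ?_ hε |>.2
    nlinarith

lemma vecMulVec_mem_feasibleSet {s : ℕ} {x : EuclideanSpace ℝ (Fin n)} (hx : ‖x‖ = 1)
    (hs : (∑ j, |x j|) ^ 2 ≤ s) : Matrix.vecMulVec x.ofLp x.ofLp ∈ feasibleSet n s := by
  refine ⟨by simpa using Matrix.posSemidef_vecMulVec_self_star x.ofLp, ?_, ?_⟩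
  · rw [Matrix.trace_vecMulVec]
    have := sum_sq_eq_norm_sq x
    rw [hx] at this
    simpa [dotProduct, sq] using this
  · refine le_trans (le_of_eq ?_) hs
    simp only [Matrix.vecMulVec_apply, abs_mul, sq, Finset.sum_mul_sum]

lemma IsOutput.norm_eq_one {m s : ℕ} {a : Fin m → Fin n → ℝ} {y : Fin m → ℝ}
    {v : EuclideanSpace ℝ (Fin n)} (h : IsOutput s a y v) : ‖v‖ = 1 := by
  obtain ⟨_, _, h⟩ := h
  exact h.1

lemma exists_isOutput {m s : ℕ} (a : Fin m → Fin n → ℝ) (y : Fin m → ℝ)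
    {x : EuclideanSpace ℝ (Fin n)} (hx : ‖x‖ = 1) (hs : (∑ j, |x j|) ^ 2 ≤ s) :
    ∃ v, IsOutput s a y v := by
  have : NeZero n := ⟨by
    rintro rfl
    have := sum_sq_eq_norm_sq x
    simp [hx] at this⟩
  obtain ⟨X, hX⟩ := exists_isSDPSolution ⟨_, vecMulVec_mem_feasibleSet hx hs⟩ (sampleMatrix a y)
  obtain ⟨v, hv⟩ := exists_isLeadingEigenvector hX.1.1.isHermitian
  exact ⟨v, X, hX, hv⟩

/-- The program recovers the signal if the sample matrix is entrywise close to a matrix whose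
quadratic form on the feasible set is governed by `x xᵀ`. -/
lemma recovers_of_entrywise_close {m s : ℕ} {a : Fin m → Fin n → ℝ} {y : Fin m → ℝ}
    {x : EuclideanSpace ℝ (Fin n)} (hx : ‖x‖ = 1) (hs : (∑ j, |x j|) ^ 2 ≤ s)
    {M : Matrix (Fin n) (Fin n) ℝ} {μ ε : ℝ} (hμ : 0 < μ) (hε : 0 < ε)
    (hM : ∀ X ∈ feasibleSet n s, (Xᵀ * M).trace ≤ μ * (x.ofLp ⬝ᵥ X *ᵥ x.ofLp))
    (hMx : ((Matrix.vecMulVec x.ofLp x.ofLp)ᵀ * M).trace = μ)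
    (hclose : ∀ j l, |sampleMatrix a y j l - M j l| * (8 * s) ≤ μ * ε ^ 2) :
    Recovers s a y x ε := by
  refine ⟨exists_isOutput a y hx hs, ?_⟩
  rintro v ⟨X, ⟨hXf, hXmax⟩, hv⟩
  set S := sampleMatrix a y
  have hxf := vecMulVec_mem_feasibleSet hx hs
  set T := Matrix.vecMulVec x.ofLp x.ofLp
  have h1 : (Tᵀ * S).trace ≤ (Xᵀ * S).trace := hXmax hxf
  have hdiff : ∀ Z ∈ feasibleSet n s, 8 * |(Zᵀ * S).trace - (Zᵀ * M).trace| ≤ μ * ε ^ 2 := by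
    rintro Z ⟨-, -, hZ⟩
    rw [trace_transpose_mul_eq_sum, trace_transpose_mul_eq_sum, ← Finset.sum_sub_distrib]
    simp only [← Finset.sum_sub_distrib, ← mul_sub]
    have hs0 : (0 : ℝ) ≤ s := Nat.cast_nonneg s
    -- For s = 0 the quotient by 8s is meaningless, but the ℓ₁ constraint then forces Z = 0.
    rcases hs0.eq_or_lt with h0 | hspos
    · have hz : ∀ i j, Z i j = 0 := by
        intro i j
        have h2 : ∑ i, ∑ j, |Z i j| = 0 := le_antisymm (by rw [h0]; exact hZ)
          (Finset.sum_nonneg fun _ _ => Finset.sum_nonneg fun _ _ => abs_nonneg _)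
        rw [Finset.sum_eq_zero_iff_of_nonneg
          (fun _ _ => Finset.sum_nonneg fun _ _ => abs_nonneg _)] at h2
        have h3 := h2 i (Finset.mem_univ i)
        rw [Finset.sum_eq_zero_iff_of_nonneg (fun _ _ => abs_nonneg _)] at h3
        exact abs_eq_zero.1 (h3 j (Finset.mem_univ j))
      simp only [hz, zero_mul, Finset.sum_const_zero, abs_zero, mul_zero]
      positivity
    have hb : ∀ j l, |S j l - M j l| ≤ μ * ε ^ 2 / (8 * s) := fun j l => by
      rw [le_div_iff₀ (by positivity)]
      exact hclose j l
    have : |∑ i, ∑ j, Z i j * (S i j - M i j)| ≤ s * (μ * ε ^ 2 / (8 * s)) := by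
      calc |∑ i, ∑ j, Z i j * (S i j - M i j)|
          ≤ ∑ i, ∑ j, |Z i j| * (μ * ε ^ 2 / (8 * s)) := by
            refine (Finset.abs_sum_le_sum_abs _ _).trans (Finset.sum_le_sum fun i _ => ?_)
            refine (Finset.abs_sum_le_sum_abs _ _).trans (Finset.sum_le_sum fun j _ => ?_)
            rw [abs_mul]
            exact mul_le_mul_of_nonneg_left (hb i j) (abs_nonneg _)
        _ = (∑ i, ∑ j, |Z i j|) * (μ * ε ^ 2 / (8 * s)) := by simp only [Finset.sum_mul]
        _ ≤ _ := mul_le_mul_of_nonneg_right hZ (by positivity)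
    calc 8 * |∑ i, ∑ j, Z i j * (S i j - M i j)| ≤ 8 * (s * (μ * ε ^ 2 / (8 * s))) := by linarith
      _ = μ * ε ^ 2 := by field_simp
  have h2 := abs_le.1 ((le_div_iff₀' (by norm_num)).2 (hdiff T hxf))
  have h3 := abs_le.1 ((le_div_iff₀' (by norm_num)).2 (hdiff X hXf))
  have h4 := hM X hXf
  rw [hMx] at h2
  -- The error με²/8 enters twice, at xxᵀ and at X.
  have h5 : μ * (1 - ε ^ 2 / 4) ≤ μ * (x.ofLp ⬝ᵥ X *ᵥ x.ofLp) := by nlinarith [h2.1, h3.2]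
  have h6 := le_of_mul_le_mul_left h5 hμ
  have h7 := hv.one_sub_sq_mul_le hXf.1 hXf.2.1 hx h6
  refine close_of_le_sq hv.1 hx hε.le ?_
  -- Write w = 1 - ⟨v, x⟩² ≤ 1. For w ≥ 0, `h7` gives w ≤ ε²/4 + wε²/4 ≤ ε²/2.
  rcases le_total (1 - (v.ofLp ⬝ᵥ x.ofLp) ^ 2) 0 with h | h
  · nlinarith
  · nlinarith

/-- In dimension one every unit vector is ±x. The case is separate because the numerical bound in
`exists_exponent` uses n² ≥ 4. -/
lemma recovers_of_dim_one {m s : ℕ} {a : Fin m → Fin 1 → ℝ} {y : Fin m → ℝ}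
    {x : EuclideanSpace ℝ (Fin 1)} (hx : ‖x‖ = 1) (hs : (∑ j, |x j|) ^ 2 ≤ s)
    {ε : ℝ} (hε : 0 < ε) : Recovers s a y x ε := by
  refine ⟨exists_isOutput a y hx hs, fun v hv => ?_⟩
  refine close_of_le_sq hv.norm_eq_one hx hε.le ?_
  have h1 := sum_sq_eq_norm_sq x
  have h2 := sum_sq_eq_norm_sq v
  rw [hx] at h1
  rw [hv.norm_eq_one] at h2
  simp only [Finset.univ_unique, Fin.default_eq_zero, Fin.isValue, Finset.sum_singleton] at h1 h2
  have : (v.ofLp ⬝ᵥ x.ofLp) ^ 2 = 1 := by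
    simp [dotProduct, mul_pow, h1, h2]
  rw [this]
  nlinarith

end Program

/-! ### Consequences of the bounds on Orlicz norms -/

/-- The infimum need not be attained and K may be 0. Passing to the positive scale K + 1 yields an
admissible c strictly below it. -/
lemma lintegral_exp_rpow_le_of_psiNorm_le {Ω : Type*} [MeasurableSpace Ω] {P : Measure Ω}
    [IsProbabilityMeasure P] {α : ℝ} (hα : 0 ≤ α) {X : Ω → ℝ} {K : ℝ≥0}
    (h : psiNorm α X P ≤ K) :
    ∫⁻ ω, ENNReal.ofReal (Real.exp ((|X ω| / ((K : ℝ) + 1)) ^ α)) ∂P ≤ 2 := by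
  have hlt : psiNorm α X P < ((K + 1 : ℝ≥0) : ℝ≥0∞) :=
    h.trans_lt (by exact_mod_cast lt_add_one K)
  simp only [psiNorm, iInf_lt_iff] at hlt
  obtain ⟨c, ⟨hc, hint⟩, hcK⟩ := hlt
  have hcK' : (c : ℝ) < K + 1 := by exact_mod_cast hcK
  have hc' : (0 : ℝ) < c := hc
  calc ∫⁻ ω, ENNReal.ofReal (Real.exp ((|X ω| / ((K : ℝ) + 1)) ^ α)) ∂P
      ≤ ∫⁻ ω, (ENNReal.ofReal (Real.exp ((|X ω| / (c : ℝ)) ^ α) - 1) + 1) ∂P := by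
        refine lintegral_mono fun ω => ?_
        rw [← ENNReal.ofReal_one, ← ENNReal.ofReal_add _ zero_le_one, sub_add_cancel]
        · refine ENNReal.ofReal_le_ofReal (Real.exp_le_exp.2 ?_)
          refine Real.rpow_le_rpow (by positivity) ?_ hα
          exact div_le_div_of_nonneg_left (abs_nonneg _) hc' hcK'.le
        · rw [sub_nonneg]
          exact Real.one_le_exp (by positivity)
    _ = ∫⁻ ω, ENNReal.ofReal (Real.exp ((|X ω| / (c : ℝ)) ^ α) - 1) ∂P + 1 := by
        rw [lintegral_add_right _ measurable_const]
        simp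
    _ ≤ 1 + 1 := by gcongr
    _ = 2 := by norm_num

lemma lintegral_abs_pow_le {Ω : Type*} [MeasurableSpace Ω] {P : Measure Ω} {X : Ω → ℝ}
    {L : ℝ} (hL : 0 < L) (h : ∫⁻ ω, ENNReal.ofReal (Real.exp (|X ω| / L)) ∂P ≤ 2) (p : ℕ) :
    ∫⁻ ω, ENNReal.ofReal (|X ω| ^ p) ∂P ≤ ENNReal.ofReal (2 * p.factorial * L ^ p) := by
  calc ∫⁻ ω, ENNReal.ofReal (|X ω| ^ p) ∂P
      ≤ ∫⁻ ω, ENNReal.ofReal (p.factorial * L ^ p) *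
          ENNReal.ofReal (Real.exp (|X ω| / L)) ∂P := by
        refine lintegral_mono fun ω => ?_
        rw [← ENNReal.ofReal_mul (by positivity)]
        refine ENNReal.ofReal_le_ofReal ?_
        have := Real.pow_div_factorial_le_exp (|X ω| / L) (by positivity) p
        rw [div_le_iff₀ (by positivity), div_pow, div_le_iff₀ (by positivity)] at this
        linarith
    _ = ENNReal.ofReal (p.factorial * L ^ p) *
          ∫⁻ ω, ENNReal.ofReal (Real.exp (|X ω| / L)) ∂P :=
        lintegral_const_mul' _ _ ENNReal.ofReal_ne_top
    _ ≤ ENNReal.ofReal (p.factorial * L ^ p) * ENNReal.ofReal 2 := by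
        gcongr
        simpa using h
    _ = _ := by
        rw [← ENNReal.ofReal_mul (by positivity)]
        congr 1; ring

/-- A second-order expansion with explicit remainder: e^u - 1 ≤ u e^u, and then u(e^u - 1) ≤ u²
e^|u|. It is used for centered u, where the linear term integrates to zero. -/
lemma exp_sub_one_sub_le (u : ℝ) : Real.exp u ≤ 1 + u + u ^ 2 * Real.exp |u| := by
  have h1 : Real.exp u - 1 ≤ u * Real.exp u := by
    have h := Real.add_one_le_exp (-u)
    have h' : Real.exp (-u) * Real.exp u = 1 := by rw [← Real.exp_add]; simp
    nlinarith [Real.exp_pos u]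
  have h2 : u * (Real.exp u - 1) ≤ u ^ 2 * Real.exp |u| := by
    rcases le_total 0 u with hu | hu
    · rw [abs_of_nonneg hu]
      nlinarith
    · have h3 := Real.add_one_le_exp u
      have h4 : 1 ≤ Real.exp |u| := Real.one_le_exp (abs_nonneg _)
      nlinarith [sq_nonneg u]
  linarith

/-- The source of self-normalization: the correction -x² leaves a quadratic majorant, so only two
moments are needed. It holds because e^(x²-x) ≥ 1 - x + x² > 0 and (1 - x + x²)(1 + x + x²) = 1 + x²
+ x⁴ ≥ 1. -/
lemma exp_sub_sq_le (x : ℝ) : Real.exp (x - x ^ 2) ≤ 1 + x + x ^ 2 := by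
  have h1 := Real.add_one_le_exp (-(x - x ^ 2))
  have h2 : Real.exp (-(x - x ^ 2)) * Real.exp (x - x ^ 2) = 1 := by rw [← Real.exp_add]; simp
  have h3 : 0 < 1 - x + x ^ 2 := by nlinarith [sq_nonneg (x - 1)]
  have h4 := Real.exp_pos (x - x ^ 2)
  have h5 : (1 - x + x ^ 2) * Real.exp (x - x ^ 2) ≤ 1 := by nlinarith
  have h6 : 1 ≤ (1 - x + x ^ 2) * (1 + x + x ^ 2) := by nlinarith [sq_nonneg x, sq_nonneg (x ^ 2)]
  nlinarith

lemma exp_mul_le_of_mem_Icc {r u : ℝ} (h0 : 0 ≤ r) (h1 : r ≤ 1) :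
    Real.exp (r * u) ≤ (1 - r) + r * Real.exp u := by
  have := convexOn_exp.2 (Set.mem_univ 0) (Set.mem_univ u) (sub_nonneg.2 h1) h0 (by ring)
  simpa using this

/-! ### Exponential moments of one coordinate and of its square. -/

namespace IsCoordinateLaw

variable {ζ : Measure ℝ} {K : ℝ≥0}

lemma lintegral_exp_sq_div_le (h : IsCoordinateLaw ζ K) :
    ∫⁻ z, ENNReal.ofReal (Real.exp (z ^ 2 / ((K : ℝ) + 1) ^ 2)) ∂ζ ≤ 2 := by
  have := h.isProbabilityMeasure
  have h1 := lintegral_exp_rpow_le_of_psiNorm_le (by norm_num) h.subgaussian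
  refine le_trans (le_of_eq ?_) h1
  congr 1 with z
  rw [Real.rpow_two, div_pow, sq_abs]

/-- With r = θL² ∈ [0, 1], convexity gives e^(θz²) ≤ (1 - r) + r e^(z²/L²). The right side
integrates to at most 1 + r ≤ e^r, a bound that tends to 1 with θ. -/
lemma lintegral_exp_mul_sq_le (h : IsCoordinateLaw ζ K) {θ : ℝ} (h0 : 0 ≤ θ)
    (h1 : θ * ((K : ℝ) + 1) ^ 2 ≤ 1) :
    ∫⁻ z, ENNReal.ofReal (Real.exp (θ * z ^ 2)) ∂ζ ≤
      ENNReal.ofReal (Real.exp (θ * ((K : ℝ) + 1) ^ 2)) := by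
  have := h.isProbabilityMeasure
  set L : ℝ := (K : ℝ) + 1 with hL
  have hLpos : 0 < L := by positivity
  set r := θ * L ^ 2 with hr
  have hr0 : 0 ≤ r := by positivity
  calc ∫⁻ z, ENNReal.ofReal (Real.exp (θ * z ^ 2)) ∂ζ
      ≤ ∫⁻ z, (ENNReal.ofReal (1 - r) +
          ENNReal.ofReal r * ENNReal.ofReal (Real.exp (z ^ 2 / L ^ 2))) ∂ζ := by
        refine lintegral_mono fun z => ?_
        rw [← ENNReal.ofReal_mul hr0, ← ENNReal.ofReal_add (by linarith) (by positivity)]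
        refine ENNReal.ofReal_le_ofReal ?_
        have := exp_mul_le_of_mem_Icc (u := z ^ 2 / L ^ 2) hr0 h1
        rwa [hr, mul_div_assoc', mul_right_comm, mul_div_assoc, div_self (by positivity),
          mul_one] at this
    _ = ENNReal.ofReal (1 - r) +
          ENNReal.ofReal r * ∫⁻ z, ENNReal.ofReal (Real.exp (z ^ 2 / L ^ 2)) ∂ζ := by
        rw [lintegral_add_left measurable_const, lintegral_const_mul' _ _ ENNReal.ofReal_ne_top]
        simp
    _ ≤ ENNReal.ofReal (1 - r) + ENNReal.ofReal r * ENNReal.ofReal 2 := by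
        gcongr
        simpa using h.lintegral_exp_sq_div_le
    _ = ENNReal.ofReal (1 + r) := by
        rw [← ENNReal.ofReal_mul hr0, ← ENNReal.ofReal_add (by linarith) (by positivity)]
        congr 1; ring
    _ ≤ _ := ENNReal.ofReal_le_ofReal (by linarith [Real.add_one_le_exp r])

lemma lintegral_comp_neg (h : IsCoordinateLaw ζ K) {F : ℝ → ℝ≥0∞} (hF : Measurable F) :
    ∫⁻ z, F (-z) ∂ζ = ∫⁻ z, F z ∂ζ := by
  conv_rhs => rw [← h.symmetric]
  rw [lintegral_map hF measurable_neg]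

lemma lintegral_exp_mul_le (h : IsCoordinateLaw ζ K) (θ : ℝ) :
    ∫⁻ z, ENNReal.ofReal (Real.exp (θ * z)) ∂ζ ≤
      ENNReal.ofReal (Real.exp (((K : ℝ) + 1) ^ 2 * θ ^ 2)) := by
  have := h.isProbabilityMeasure
  set L : ℝ := (K : ℝ) + 1 with hL
  have hLpos : 0 < L := by positivity
  -- For small θ, symmetry replaces e^(θz) by cosh(θz) ≤ e^(θ²z²/2). For large θ, θz ≤ θ²L²/2 +
  -- z²/(2L²), and the extra factor e^(1/2) is absorbed by the other half of θ²L².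
  rcases le_total (θ ^ 2 / 2 * L ^ 2) 1 with hθ | hθ
  · have hm : Measurable fun z : ℝ => ENNReal.ofReal (Real.exp (θ * z)) := by fun_prop
    have h1 : ∫⁻ z, ENNReal.ofReal (Real.exp (θ * z)) ∂ζ +
        ∫⁻ z, ENNReal.ofReal (Real.exp (θ * -z)) ∂ζ ≤
        ∫⁻ z, ENNReal.ofReal (Real.exp (θ ^ 2 / 2 * z ^ 2)) ∂ζ +
        ∫⁻ z, ENNReal.ofReal (Real.exp (θ ^ 2 / 2 * z ^ 2)) ∂ζ := by
      rw [← lintegral_add_left (by fun_prop), ← lintegral_add_left (by fun_prop)]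
      refine lintegral_mono fun z => ?_
      rw [← ENNReal.ofReal_add (by positivity) (by positivity),
        ← ENNReal.ofReal_add (by positivity) (by positivity)]
      refine ENNReal.ofReal_le_ofReal ?_
      have := Real.cosh_le_exp_half_sq (θ * z)
      rw [Real.cosh_eq] at this
      have e1 : (θ * z) ^ 2 / 2 = θ ^ 2 / 2 * z ^ 2 := by ring
      rw [e1, ← mul_neg] at this
      linarith
    rw [h.lintegral_comp_neg hm] at h1
    have h2 := h.lintegral_exp_mul_sq_le (by positivity) hθ
    have h3 : ∫⁻ z, ENNReal.ofReal (Real.exp (θ * z)) ∂ζ ≤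
        ∫⁻ z, ENNReal.ofReal (Real.exp (θ ^ 2 / 2 * z ^ 2)) ∂ζ := by
      rw [← two_mul, ← two_mul] at h1
      exact (ENNReal.mul_le_mul_iff_right (by norm_num) (by norm_num)).1 h1
    refine h3.trans (h2.trans (ENNReal.ofReal_le_ofReal (Real.exp_le_exp.2 ?_)))
    nlinarith [mul_nonneg (sq_nonneg θ) (sq_nonneg L)]
  · have hr : 1 / (2 * L ^ 2) * L ^ 2 = 1 / 2 := by field_simp
    calc ∫⁻ z, ENNReal.ofReal (Real.exp (θ * z)) ∂ζ
        ≤ ∫⁻ z, ENNReal.ofReal (Real.exp (θ ^ 2 * L ^ 2 / 2)) *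
            ENNReal.ofReal (Real.exp (1 / (2 * L ^ 2) * z ^ 2)) ∂ζ := by
          refine lintegral_mono fun z => ?_
          rw [← ENNReal.ofReal_mul (by positivity), ← Real.exp_add]
          refine ENNReal.ofReal_le_ofReal (Real.exp_le_exp.2 ?_)
          have e : θ ^ 2 * L ^ 2 / 2 + 1 / (2 * L ^ 2) * z ^ 2 - θ * z =
              (θ * L - z / L) ^ 2 / 2 := by
            field_simp; ring
          nlinarith [sq_nonneg (θ * L - z / L)]
      _ = ENNReal.ofReal (Real.exp (θ ^ 2 * L ^ 2 / 2)) *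
            ∫⁻ z, ENNReal.ofReal (Real.exp (1 / (2 * L ^ 2) * z ^ 2)) ∂ζ :=
          lintegral_const_mul' _ _ ENNReal.ofReal_ne_top
      _ ≤ ENNReal.ofReal (Real.exp (θ ^ 2 * L ^ 2 / 2)) *
            ENNReal.ofReal (Real.exp (1 / 2)) := by
          gcongr
          have := h.lintegral_exp_mul_sq_le (θ := 1 / (2 * L ^ 2)) (by positivity)
            (by rw [hr]; norm_num)
          rwa [hr] at this
      _ ≤ _ := by
          rw [← ENNReal.ofReal_mul (by positivity), ← Real.exp_add]
          refine ENNReal.ofReal_le_ofReal (Real.exp_le_exp.2 ?_)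
          nlinarith

lemma lintegral_pow_le (h : IsCoordinateLaw ζ K) (p : ℕ) :
    ∫⁻ z, ENNReal.ofReal ((z ^ 2) ^ p) ∂ζ ≤
      ENNReal.ofReal (2 * p.factorial * (((K : ℝ) + 1) ^ 2) ^ p) := by
  have := lintegral_abs_pow_le (P := ζ) (X := fun z => z ^ 2) (L := ((K : ℝ) + 1) ^ 2)
    (by positivity) (by simpa only [abs_sq] using h.lintegral_exp_sq_div_le) p
  simpa only [abs_sq] using this

lemma integrable_exp_sq_div (h : IsCoordinateLaw ζ K) :
    Integrable (fun z => Real.exp (z ^ 2 / ((K : ℝ) + 1) ^ 2)) ζ := by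
  refine (lintegral_ofReal_ne_top_iff_integrable (by fun_prop) ?_).1 ?_
  · exact Filter.Eventually.of_forall fun z => (Real.exp_pos _).le
  · exact ne_top_of_le_ne_top (by norm_num) h.lintegral_exp_sq_div_le

lemma integral_exp_sq_div_le (h : IsCoordinateLaw ζ K) :
    ∫ z, Real.exp (z ^ 2 / ((K : ℝ) + 1) ^ 2) ∂ζ ≤ 2 := by
  have h1 := h.lintegral_exp_sq_div_le
  rw [← ofReal_integral_eq_lintegral_ofReal h.integrable_exp_sq_div
    (Filter.Eventually.of_forall fun z => (Real.exp_pos _).le)] at h1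
  rwa [← ENNReal.ofReal_ofNat 2, ENNReal.ofReal_le_ofReal_iff (by norm_num)] at h1

lemma integrable_sq (h : IsCoordinateLaw ζ K) : Integrable (fun z : ℝ => z ^ 2) ζ := by
  refine (lintegral_ofReal_ne_top_iff_integrable (by fun_prop) ?_).1 ?_
  · exact Filter.Eventually.of_forall fun z => sq_nonneg z
  · have := h.lintegral_pow_le 1
    simp only [pow_one] at this
    exact ne_top_of_le_ne_top ENNReal.ofReal_ne_top this

lemma integral_sq (h : IsCoordinateLaw ζ K) : ∫ z, z ^ 2 ∂ζ = 1 := by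
  have := h.unit_variance
  rwa [variance_of_integral_eq_zero (by fun_prop) h.centered] at this

/-- z² - 1 is centered and subexponential, so its transform is quadratic for small |θ|. In 48 = 8 ·
3 · 2, the 8 comes from X² ≤ 2!(2L²)² e^(|X|/(2L²)), the 3 bounds e, and the 2 bounds the integral
of e^(z²/L²). -/
lemma lintegral_exp_mul_sq_sub_one_le (h : IsCoordinateLaw ζ K) {θ : ℝ}
    (hθ : |θ| * (2 * ((K : ℝ) + 1) ^ 2) ≤ 1) :
    ∫⁻ z, ENNReal.ofReal (Real.exp (θ * (z ^ 2 - 1))) ∂ζ ≤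
      ENNReal.ofReal (Real.exp (48 * ((K : ℝ) + 1) ^ 4 * θ ^ 2)) := by
  have := h.isProbabilityMeasure
  have hint := h.integrable_exp_sq_div
  have hle := h.integral_exp_sq_div_le
  set L : ℝ := (K : ℝ) + 1 with hL
  have hL1 : 1 ≤ L := by
    have : (0 : ℝ) ≤ K := K.2
    linarith
  have hLpos : 0 < L := by positivity
  have key : ∀ z : ℝ, Real.exp (θ * (z ^ 2 - 1)) ≤
      1 + θ * (z ^ 2 - 1) + 24 * L ^ 4 * θ ^ 2 * Real.exp (z ^ 2 / L ^ 2) := by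
    intro z
    set X := z ^ 2 - 1 with hX
    have hXabs : |X| ≤ z ^ 2 + 1 := by
      rw [abs_le]; constructor <;> nlinarith [sq_nonneg z]
    have h1 := exp_sub_one_sub_le (θ * X)
    have h2 : |θ * X| ≤ |X| / (2 * L ^ 2) := by
      rw [abs_mul, le_div_iff₀ (by positivity)]
      nlinarith [abs_nonneg X]
    have h3 : X ^ 2 ≤ 8 * L ^ 4 * Real.exp (|X| / (2 * L ^ 2)) := by
      have := Real.pow_div_factorial_le_exp (|X| / (2 * L ^ 2)) (by positivity) 2
      rw [div_pow, sq_abs, div_div, div_le_iff₀ (by positivity)] at this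
      refine this.trans (le_of_eq ?_)
      simp only [Nat.factorial]
      push_cast
      ring
    have h4 : Real.exp (|X| / (2 * L ^ 2)) * Real.exp (|X| / (2 * L ^ 2)) ≤
        3 * Real.exp (z ^ 2 / L ^ 2) := by
      rw [← Real.exp_add, ← add_div]
      calc Real.exp ((|X| + |X|) / (2 * L ^ 2)) ≤ Real.exp (1 + z ^ 2 / L ^ 2) := by
            refine Real.exp_le_exp.2 ?_
            rw [div_le_iff₀ (by positivity)]
            have : (1 + z ^ 2 / L ^ 2) * (2 * L ^ 2) = 2 * L ^ 2 + 2 * z ^ 2 := by field_simp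
            rw [this]
            nlinarith
        _ = Real.exp 1 * Real.exp (z ^ 2 / L ^ 2) := Real.exp_add _ _
        _ ≤ 3 * Real.exp (z ^ 2 / L ^ 2) := by
            gcongr
            linarith [Real.exp_one_lt_d9]
    have h5 : (θ * X) ^ 2 * Real.exp |θ * X| ≤ 24 * L ^ 4 * θ ^ 2 * Real.exp (z ^ 2 / L ^ 2) := by
      calc (θ * X) ^ 2 * Real.exp |θ * X|
          ≤ (θ ^ 2 * (8 * L ^ 4 * Real.exp (|X| / (2 * L ^ 2)))) *
              Real.exp (|X| / (2 * L ^ 2)) := by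
            rw [mul_pow]
            gcongr
        _ = 8 * L ^ 4 * θ ^ 2 *
              (Real.exp (|X| / (2 * L ^ 2)) * Real.exp (|X| / (2 * L ^ 2))) := by ring
        _ ≤ 8 * L ^ 4 * θ ^ 2 * (3 * Real.exp (z ^ 2 / L ^ 2)) := by gcongr
        _ = _ := by ring
    linarith
  set g : ℝ → ℝ := fun z =>
    1 + θ * (z ^ 2 - 1) + 24 * L ^ 4 * θ ^ 2 * Real.exp (z ^ 2 / L ^ 2) with hg
  have i1 : Integrable (fun z : ℝ => θ * (z ^ 2 - 1)) ζ :=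
    (h.integrable_sq.sub (integrable_const 1)).const_mul θ
  have i2 : Integrable (fun z : ℝ => 24 * L ^ 4 * θ ^ 2 * Real.exp (z ^ 2 / L ^ 2)) ζ :=
    hint.const_mul _
  have i3 : Integrable (fun z : ℝ => 1 + θ * (z ^ 2 - 1)) ζ := (integrable_const 1).add i1
  have hgi : Integrable g ζ := i3.add i2
  calc ∫⁻ z, ENNReal.ofReal (Real.exp (θ * (z ^ 2 - 1))) ∂ζ
      ≤ ∫⁻ z, ENNReal.ofReal (g z) ∂ζ := lintegral_mono fun z => ENNReal.ofReal_le_ofReal (key z)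
    _ = ENNReal.ofReal (∫ z, g z ∂ζ) :=
        (ofReal_integral_eq_lintegral_ofReal hgi
          (Filter.Eventually.of_forall fun z => (Real.exp_pos _).le.trans (key z))).symm
    _ ≤ _ := by
        refine ENNReal.ofReal_le_ofReal ?_
        have : ∫ z, g z ∂ζ = 1 + 24 * L ^ 4 * θ ^ 2 * ∫ z, Real.exp (z ^ 2 / L ^ 2) ∂ζ := by
          rw [hg, integral_add i3 i2, integral_add (integrable_const 1) i1,
            integral_const_mul, integral_const_mul,
            integral_sub h.integrable_sq (integrable_const 1), h.integral_sq]
          simp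
        rw [this]
        have h1 := Real.add_one_le_exp (48 * L ^ 4 * θ ^ 2)
        have h2 : 24 * L ^ 4 * θ ^ 2 * ∫ z, Real.exp (z ^ 2 / L ^ 2) ∂ζ ≤
            24 * L ^ 4 * θ ^ 2 * 2 := mul_le_mul_of_nonneg_left hle (by positivity)
        linarith

end IsCoordinateLaw

/-! ### The law of a sample -/

section Law

variable {ζ : Measure ℝ} {K : ℝ≥0} {E : Type*} [MeasurableSpace E] {η : Measure E}

lemma isProbabilityMeasure_copiesLaw [IsProbabilityMeasure ζ] [IsProbabilityMeasure η] (n : ℕ) :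
    IsProbabilityMeasure (copiesLaw ζ η n) := by
  unfold copiesLaw; infer_instance

lemma measurePreserving_coord [IsProbabilityMeasure ζ] [IsProbabilityMeasure η] {n : ℕ}
    (j : Fin n) : MeasurePreserving (fun p : (Fin n → ℝ) × E => p.1 j) (copiesLaw ζ η n) ζ :=
  (measurePreserving_eval (fun _ : Fin n => ζ) j).comp measurePreserving_fst

lemma measurePreserving_update_pi [IsProbabilityMeasure ζ] {n : ℕ} (j : Fin n) :
    MeasurePreserving (fun q : (Fin n → ℝ) × ℝ => Function.update q.1 j q.2)
      ((Measure.pi fun _ : Fin n => ζ).prod ζ) (Measure.pi fun _ : Fin n => ζ) := by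
  have hm : Measurable fun q : (Fin n → ℝ) × ℝ => Function.update q.1 j q.2 := by
    refine measurable_pi_lambda _ fun i => ?_
    by_cases h : i = j
    · subst h; simpa using measurable_snd
    · simp only [Function.update_of_ne h]; fun_prop
  refine ⟨hm, (Measure.pi_eq fun s hs => ?_).symm⟩
  rw [Measure.map_apply hm (MeasurableSet.univ_pi hs)]
  have : (fun q : (Fin n → ℝ) × ℝ => Function.update q.1 j q.2) ⁻¹' Set.univ.pi s =
      (Set.univ.pi (Function.update s j Set.univ)) ×ˢ s j := by
    ext q
    simp only [Set.mem_preimage, Set.mem_univ_pi, Set.mem_prod]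
    constructor
    · intro h
      refine ⟨fun i => ?_, by simpa using h j⟩
      by_cases hi : i = j
      · subst hi; simp
      · simpa [Function.update_of_ne hi] using h i
    · rintro ⟨h1, h2⟩ i
      by_cases hi : i = j
      · subst hi; simpa using h2
      · simpa [Function.update_of_ne hi] using h1 i
  rw [this, Measure.prod_prod, Measure.pi_pi]
  rw [← Finset.mul_prod_erase _ (fun i => ζ (s i)) (Finset.mem_univ j),
    ← Finset.mul_prod_erase _ _ (Finset.mem_univ j)]
  simp only [Function.update_self, measure_univ, one_mul]
  rw [mul_comm]
  congr 1
  refine Finset.prod_congr rfl fun i hi => ?_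
  rw [Function.update_of_ne (Finset.ne_of_mem_erase hi)]

/-- Resampling one coordinate preserves the law. -/
lemma measurePreserving_update [IsProbabilityMeasure ζ] [IsProbabilityMeasure η] {n : ℕ}
    (j : Fin n) :
    MeasurePreserving (fun q : ((Fin n → ℝ) × E) × ℝ => (Function.update q.1.1 j q.2, q.1.2))
      ((copiesLaw ζ η n).prod ζ) (copiesLaw ζ η n) := by
  have h1 := (measurePreserving_update_pi (ζ := ζ) j).prod (MeasurePreserving.id η)
  have h2 : MeasurePreserving (fun q : ((Fin n → ℝ) × E) × ℝ => ((q.1.1, q.2), q.1.2))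
      ((copiesLaw ζ η n).prod ζ) (((Measure.pi fun _ : Fin n => ζ).prod ζ).prod η) := by
    have e1 := measurePreserving_prodAssoc (Measure.pi fun _ : Fin n => ζ) η ζ
    have e2 := (MeasurePreserving.id (Measure.pi fun _ : Fin n => ζ)).prod
      (Measure.measurePreserving_swap (μ := η) (ν := ζ))
    have e3 := (measurePreserving_prodAssoc (Measure.pi fun _ : Fin n => ζ) ζ η).symm
    exact e3.comp (e2.comp e1)
  exact h1.comp h2

/-- Serves as conditioning on everything but coordinate j: the inner integral averages over that
coordinate alone. -/
lemma lintegral_eq_lintegral_update [IsProbabilityMeasure ζ] [IsProbabilityMeasure η] {n : ℕ}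
    (j : Fin n) {F : (Fin n → ℝ) × E → ℝ≥0∞} (hF : Measurable F) :
    ∫⁻ p, F p ∂(copiesLaw ζ η n) =
      ∫⁻ p, ∫⁻ z, F (Function.update p.1 j z, p.2) ∂ζ ∂(copiesLaw ζ η n) := by
  have h := measurePreserving_update (ζ := ζ) (η := η) j
  rw [← h.lintegral_comp hF]
  exact lintegral_prod _ (hF.comp h.measurable).aemeasurable

/-- A signed selection of coordinates preserves the law. -/
lemma IsCoordinateLaw.measurePreserving_signed_pi (h : IsCoordinateLaw ζ K) {k n : ℕ}
    {g : Fin k → Fin n} (hg : Function.Injective g) {c : Fin k → ℝ}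
    (hc : ∀ i, c i = 1 ∨ c i = -1) :
    MeasurePreserving (fun (a : Fin n → ℝ) i => c i * a (g i))
      (Measure.pi fun _ : Fin n => ζ) (Measure.pi fun _ : Fin k => ζ) := by
  have := h.isProbabilityMeasure
  refine ⟨by fun_prop, ?_⟩
  have h1 : iIndepFun (fun (j : Fin n) (a : Fin n → ℝ) => a j) (Measure.pi fun _ : Fin n => ζ) :=
    iIndepFun_pi (X := fun _ (z : ℝ) => z) (fun _ => aemeasurable_id)
  have h2 : iIndepFun (fun (i : Fin k) (a : Fin n → ℝ) => c i * a (g i))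
      (Measure.pi fun _ : Fin n => ζ) :=
    (h1.precomp hg).comp (fun i z => c i * z) (fun i => by fun_prop)
  have hm : ∀ i : Fin k, AEMeasurable (fun a : Fin n → ℝ => c i * a (g i))
      (Measure.pi fun _ : Fin n => ζ) := fun i =>
    (by fun_prop : Measurable fun a : Fin n → ℝ => c i * a (g i)).aemeasurable
  refine ((iIndepFun_iff_map_fun_eq_pi_map hm).1 h2).trans ?_
  congr 1
  ext1 i
  have h3 : MeasurePreserving (fun z : ℝ => c i * z) ζ ζ := by
    rcases hc i with hi | hi
    · simp only [hi, one_mul]; exact MeasurePreserving.id ζ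
    · simp only [hi, neg_one_mul]; exact ⟨measurable_neg, h.symmetric⟩
  exact (h3.comp (measurePreserving_eval (fun _ : Fin n => ζ) (g i))).map_eq

lemma IsCoordinateLaw.measurePreserving_signed (h : IsCoordinateLaw ζ K)
    [IsProbabilityMeasure η] {k n : ℕ}
    {g : Fin k → Fin n} (hg : Function.Injective g) {c : Fin k → ℝ}
    (hc : ∀ i, c i = 1 ∨ c i = -1) :
    MeasurePreserving (fun p : (Fin n → ℝ) × E => ((fun i => c i * p.1 (g i) : Fin k → ℝ), p.2))
      (copiesLaw ζ η n) (copiesLaw ζ η k) :=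
  have := h.isProbabilityMeasure
  (h.measurePreserving_signed_pi hg hc).prod (MeasurePreserving.id η)

lemma covariance_comp_of_measurePreserving {Ω Ω' : Type*} [MeasurableSpace Ω]
    [MeasurableSpace Ω'] {P : Measure Ω} {Q : Measure Ω'} {T : Ω → Ω'}
    (hT : MeasurePreserving T P Q) {X Y : Ω' → ℝ} (hX : Measurable X) (hY : Measurable Y) :
    cov[X, Y; Q] = cov[fun ω => X (T ω), fun ω => Y (T ω); P] := by
  have := covariance_map (μ := P) (Z := T) (X := X) (Y := Y) hX.aestronglyMeasurable
    hY.aestronglyMeasurable hT.measurable.aemeasurable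
  rwa [hT.map_eq] at this

end Law

/-! ### The support of an admissible vector -/

/-- `g` enumerates the support of `x`, where the entries are `c i / √k`. -/
structure IsSignedSupport {n k : ℕ} (x : EuclideanSpace ℝ (Fin n)) (g : Fin k → Fin n)
    (c : Fin k → ℝ) : Prop where
  pos : 0 < k
  injective : Function.Injective g
  sign : ∀ i, c i = 1 ∨ c i = -1
  apply : ∀ i, x (g i) = c i / √(k : ℝ)
  zero : ∀ j ∉ Set.range g, x j = 0

/-- The entries on I are nonzero, so I is exactly the support of x; it is nonempty since ‖x‖ = 1. -/
lemma IsAdmissible.exists_isSignedSupport {n s : ℕ} {x : EuclideanSpace ℝ (Fin n)}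
    (h : IsAdmissible s x) :
    supportSize x ≤ s ∧ ∃ (g : Fin (supportSize x) → Fin n) (c : Fin (supportSize x) → ℝ),
      IsSignedSupport x g c := by
  obtain ⟨hx, I, hI, h1, h0⟩ := h
  have hIne : I.Nonempty := by
    rw [Finset.nonempty_iff_ne_empty]
    rintro rfl
    have := sum_sq_eq_norm_sq x
    simp [hx, h0] at this
  have hpos : (0 : ℝ) < √(I.card : ℝ) := Real.sqrt_pos.2 (by exact_mod_cast hIne.card_pos)
  have hfil : (Finset.univ.filter fun j => x j ≠ 0) = I := by
    refine Finset.ext fun j => ?_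
    simp only [Finset.mem_filter, Finset.mem_univ, true_and]
    constructor
    · intro hj
      by_contra hjI
      exact hj (h0 j hjI)
    · intro hj
      have hp : 0 < 1 / √(I.card : ℝ) := by positivity
      rcases h1 j hj with h | h <;> rw [h]
      · exact hp.ne'
      · exact (neg_neg_of_pos hp).ne
  have hcard : supportSize x = I.card := by rw [supportSize, hfil]
  rw [hcard]
  refine ⟨hI, fun i => I.equivFin.symm i, fun i => √(I.card : ℝ) * x (I.equivFin.symm i),
    hIne.card_pos, ?_, ?_, ?_, ?_⟩
  · exact Subtype.val_injective.comp I.equivFin.symm.injective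
  · intro i
    rcases h1 _ (I.equivFin.symm i).2 with h | h
    · left; rw [h]; field_simp
    · right; rw [h]; field_simp
  · intro i; field_simp
  · intro j hj
    refine h0 j fun hjI => hj ⟨I.equivFin ⟨j, hjI⟩, by simp⟩

namespace IsSignedSupport

variable {n k : ℕ} {x : EuclideanSpace ℝ (Fin n)} {g : Fin k → Fin n} {c : Fin k → ℝ}

lemma sum_mul (h : IsSignedSupport x g c) (u : Fin n → ℝ) (φ : ℝ → ℝ) (hφ : φ 0 = 0) :
    ∑ j, u j * φ (x j) = ∑ i, u (g i) * φ (x (g i)) := by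
  rw [← Finset.sum_image (s := Finset.univ) (g := g) (f := fun j => u j * φ (x j))
    (fun a _ b _ hab => h.injective hab)]
  symm
  refine Finset.sum_subset (Finset.subset_univ _) fun j _ hj => ?_
  rw [h.zero j (by simpa using hj), hφ, mul_zero]

lemma le_dim (h : IsSignedSupport x g c) : k ≤ n := by
  simpa using Fintype.card_le_of_injective g h.injective

lemma sqrt_pos (h : IsSignedSupport x g c) : 0 < √(k : ℝ) :=
  Real.sqrt_pos.2 (by exact_mod_cast h.pos)

lemma sign_sq (h : IsSignedSupport x g c) (i : Fin k) : c i * c i = 1 := by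
  rcases h.sign i with hi | hi <;> simp [hi]

lemma sum_abs_sq (h : IsSignedSupport x g c) : (∑ j, |x j|) ^ 2 = k := by
  have h1 := h.sum_mul (fun _ => 1) (fun t => |t|) abs_zero
  simp only [one_mul] at h1
  have h2 : ∀ i, |x (g i)| = 1 / √(k : ℝ) := fun i => by
    rw [h.apply i, abs_div, abs_of_pos h.sqrt_pos]
    rcases h.sign i with hi | hi <;> simp [hi]
  have hk := h.sqrt_pos
  have hsq : √(k : ℝ) ^ 2 = k := Real.sq_sqrt (Nat.cast_nonneg k)
  rw [h1]
  simp only [h2, Finset.sum_const, Finset.card_univ, Fintype.card_fin, nsmul_eq_mul]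
  rw [mul_one_div, div_pow, hsq]
  have : (k : ℝ) ≠ 0 := by exact_mod_cast h.pos.ne'
  field_simp

/-- ⟨a, x⟩ is √k times the mean of the signed coordinates c i * a (g i). By symmetry of the law
these are again k independent copies, so hypotheses on `linkValue` transfer to the measurement. -/
lemma measurement_eq {E : Type*} (h : IsSignedSupport x g c) (f : ℝ → E → ℝ)
    (p : (Fin n → ℝ) × E) :
    measurement f x p.1 p.2 = linkValue f k ((fun i => c i * p.1 (g i) : Fin k → ℝ), p.2) := by
  unfold measurement linkValue scaledMean mean
  congr 1
  have := h.sum_mul p.1 id rfl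
  simp only [id] at this
  rw [this]
  have hk := h.sqrt_pos
  have hsq : √(k : ℝ) * √(k : ℝ) = k := Real.mul_self_sqrt (Nat.cast_nonneg k)
  have hk' : √(k : ℝ) / k = 1 / √(k : ℝ) := by
    rw [← hsq]; field_simp; rw [Real.sqrt_sq hk.le]
  rw [mul_div_assoc', mul_comm, mul_div_assoc, hk', Finset.sum_mul]
  refine Finset.sum_congr rfl fun i _ => ?_
  rw [h.apply i]
  ring

lemma measurement_update {E : Type*} (h : IsSignedSupport x g c) (f : ℝ → E → ℝ)
    {j : Fin n} (hj : j ∉ Set.range g) (a : Fin n → ℝ) (z : ℝ) (e : E) :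
    measurement f x (Function.update a j z) e = measurement f x a e := by
  unfold measurement
  congr 1
  refine Finset.sum_congr rfl fun i _ => ?_
  by_cases hi : i = j
  · subst hi; rw [h.zero i hj]; simp
  · rw [Function.update_of_ne hi]

end IsSignedSupport

/-! ### Moments -/

/-- A bound for the moments of the coordinates and of the measurements that are used. -/
noncomputable def momentBound (K : ℝ≥0) : ℝ := 2 * Nat.factorial 8 * ((K : ℝ) + 1) ^ 16

lemma one_le_momentBound (K : ℝ≥0) : 1 ≤ momentBound K := by
  have h : (1 : ℝ) ≤ ((K : ℝ) + 1) ^ 16 := one_le_pow₀ (by linarith [K.2])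
  have h8 : (1 : ℝ) ≤ Nat.factorial 8 := by exact_mod_cast Nat.factorial_pos 8
  unfold momentBound
  nlinarith

/-- The exponents 8 and 16 come from (y² a_j⁴)² ≤ (|y|⁸ + a_j¹⁶)/2, the highest moment in the
argument. -/
lemma le_momentBound (K : ℝ≥0) {q r : ℕ} (hq : q ≤ 8) (hr : r ≤ 16) :
    2 * (q.factorial : ℝ) * ((K : ℝ) + 1) ^ r ≤ momentBound K := by
  have h1 : (1 : ℝ) ≤ (K : ℝ) + 1 := by linarith [K.2]
  have h2 : (q.factorial : ℝ) ≤ Nat.factorial 8 := by exact_mod_cast Nat.factorial_le hq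
  have h3 : ((K : ℝ) + 1) ^ r ≤ ((K : ℝ) + 1) ^ 16 := pow_le_pow_right₀ h1 hr
  unfold momentBound
  gcongr

lemma integrable_and_integral_le {Ω : Type*} [MeasurableSpace Ω] {P : Measure Ω} {F : Ω → ℝ}
    (hF : Measurable F) (h0 : ∀ ω, 0 ≤ F ω) {A : ℝ} (hA : 0 ≤ A)
    (h : ∫⁻ ω, ENNReal.ofReal (F ω) ∂P ≤ ENNReal.ofReal A) :
    Integrable F P ∧ ∫ ω, F ω ∂P ≤ A := by
  have hint : Integrable F P :=
    (lintegral_ofReal_ne_top_iff_integrable hF.aestronglyMeasurable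
      (Filter.Eventually.of_forall h0)).1 (ne_top_of_le_ne_top ENNReal.ofReal_ne_top h)
  refine ⟨hint, ?_⟩
  rwa [← ofReal_integral_eq_lintegral_ofReal hint (Filter.Eventually.of_forall h0),
    ENNReal.ofReal_le_ofReal_iff hA] at h

section Moments

variable {ζ : Measure ℝ} {K : ℝ≥0} {E : Type*} [MeasurableSpace E] {η : Measure E}
  [IsProbabilityMeasure η]

lemma IsCoordinateLaw.coord_moment (h : IsCoordinateLaw ζ K) {n : ℕ} (j : Fin n) {q : ℕ}
    (hq : q ≤ 8) :
    Integrable (fun p : (Fin n → ℝ) × E => (p.1 j ^ 2) ^ q) (copiesLaw ζ η n) ∧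
      ∫ p : (Fin n → ℝ) × E, (p.1 j ^ 2) ^ q ∂(copiesLaw ζ η n) ≤ momentBound K := by
  have := h.isProbabilityMeasure
  refine integrable_and_integral_le (by fun_prop) (fun p => by positivity)
    (by linarith [one_le_momentBound K]) ?_
  have h1 := (measurePreserving_coord (ζ := ζ) (η := η) j).lintegral_comp
    (f := fun z => ENNReal.ofReal ((z ^ 2) ^ q)) (by fun_prop)
  rw [h1]
  refine (h.lintegral_pow_le q).trans (ENNReal.ofReal_le_ofReal ?_)
  rw [← pow_mul]
  exact le_momentBound K hq (by omega)

lemma measurable_linkValue {f : ℝ → E → ℝ} (hf : Measurable (Function.uncurry f)) (k : ℕ) :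
    Measurable (linkValue f k) := by
  have : Measurable fun p : (Fin k → ℝ) × E => (scaledMean k p, p.2) := by
    unfold scaledMean mean; fun_prop
  exact hf.comp this

lemma measurable_measurement {f : ℝ → E → ℝ} (hf : Measurable (Function.uncurry f)) {n : ℕ}
    (x : EuclideanSpace ℝ (Fin n)) :
    Measurable fun p : (Fin n → ℝ) × E => measurement f x p.1 p.2 := by
  have : Measurable fun p : (Fin n → ℝ) × E => (∑ j, p.1 j * x j, p.2) := by fun_prop
  exact hf.comp this

variable {n k : ℕ} {x : EuclideanSpace ℝ (Fin n)} {g : Fin k → Fin n} {c : Fin k → ℝ}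
  {f : ℝ → E → ℝ}

lemma lintegral_exp_measurement_le (h : IsCoordinateLaw ζ K)
    (hf : Measurable (Function.uncurry f)) (hx : IsSignedSupport x g c)
    (hψ : psiNorm 1 (linkValue f k) (copiesLaw ζ η k) ≤ K) :
    ∫⁻ p, ENNReal.ofReal (Real.exp (|measurement f x p.1 p.2| / ((K : ℝ) + 1)))
      ∂(copiesLaw ζ η n) ≤ 2 := by
  have := h.isProbabilityMeasure
  have := isProbabilityMeasure_copiesLaw (ζ := ζ) (η := η) k
  have h1 := lintegral_exp_rpow_le_of_psiNorm_le zero_le_one hψ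
  simp only [Real.rpow_one] at h1
  rw [← (h.measurePreserving_signed (η := η) hx.injective hx.sign).lintegral_comp
    (by have := measurable_linkValue hf k; fun_prop)] at h1
  simpa only [hx.measurement_eq f] using h1

lemma measurement_moment (h : IsCoordinateLaw ζ K)
    (hf : Measurable (Function.uncurry f)) (hx : IsSignedSupport x g c)
    (hψ : psiNorm 1 (linkValue f k) (copiesLaw ζ η k) ≤ K) {q : ℕ} (hq : q ≤ 8) :
    Integrable (fun p => |measurement f x p.1 p.2| ^ q) (copiesLaw ζ η n) ∧
      ∫ p, |measurement f x p.1 p.2| ^ q ∂(copiesLaw ζ η n) ≤ momentBound K := by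
  have hm := measurable_measurement hf x
  refine integrable_and_integral_le (by fun_prop) (fun p => by positivity)
    (by linarith [one_le_momentBound K]) ?_
  refine (lintegral_abs_pow_le (by positivity)
    (lintegral_exp_measurement_le h hf hx hψ) q).trans (ENNReal.ofReal_le_ofReal ?_)
  exact le_momentBound K hq (by omega)

lemma memLp_measurement (h : IsCoordinateLaw ζ K)
    (hf : Measurable (Function.uncurry f)) (hx : IsSignedSupport x g c)
    (hψ : psiNorm 1 (linkValue f k) (copiesLaw ζ η k) ≤ K) :
    MemLp (fun p => measurement f x p.1 p.2) 2 (copiesLaw ζ η n) := by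
  rw [memLp_two_iff_integrable_sq (measurable_measurement hf x).aestronglyMeasurable]
  simpa only [sq_abs] using (measurement_moment h hf hx hψ (q := 2) (by norm_num)).1

lemma IsCoordinateLaw.memLp_mul (h : IsCoordinateLaw ζ K) {n : ℕ} (j l : Fin n) :
    MemLp (fun p : (Fin n → ℝ) × E => p.1 j * p.1 l) 2 (copiesLaw ζ η n) := by
  rw [memLp_two_iff_integrable_sq (by fun_prop)]
  refine Integrable.mono' ((h.coord_moment (η := η) j (q := 2) (by norm_num)).1.add
    (h.coord_moment (η := η) l (q := 2) (by norm_num)).1) (by fun_prop) ?_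
  refine Filter.Eventually.of_forall fun p => ?_
  rw [Real.norm_of_nonneg (sq_nonneg _)]
  simp only [Pi.add_apply]
  nlinarith [sq_nonneg (p.1 j ^ 2 - p.1 l ^ 2), sq_nonneg (p.1 j ^ 2), sq_nonneg (p.1 l ^ 2)]

lemma IsCoordinateLaw.integral_mul (h : IsCoordinateLaw ζ K) {n : ℕ} (j l : Fin n) :
    ∫ p : (Fin n → ℝ) × E, p.1 j * p.1 l ∂(copiesLaw ζ η n) = if j = l then 1 else 0 := by
  have := h.isProbabilityMeasure
  split_ifs with hjl
  · subst hjl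
    have hmp := measurePreserving_coord (ζ := ζ) (η := η) j
    rw [← h.integral_sq]
    conv_rhs => rw [← hmp.map_eq]
    rw [integral_map hmp.measurable.aemeasurable (by fun_prop)]
    simp only [sq]
  -- Flipping the sign of coordinate j preserves the law and negates the integrand.
  · have hmp := h.measurePreserving_signed (η := η) (g := id) (Function.injective_id (α := Fin n))
      (c := fun i => if i = j then -1 else 1) (fun i => by by_cases hi : i = j <;> simp [hi])
    have h1 : ∫ p : (Fin n → ℝ) × E, p.1 j * p.1 l ∂(copiesLaw ζ η n) =
        ∫ p : (Fin n → ℝ) × E, -(p.1 j * p.1 l) ∂(copiesLaw ζ η n) := by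
      conv_lhs => rw [← hmp.map_eq]
      rw [integral_map hmp.measurable.aemeasurable (by fun_prop)]
      simp [Ne.symm hjl]
    rw [integral_neg] at h1
    linarith

end Moments

/-! ### The expectation of the sample matrix -/

/-- The matrix of covariances of the products of coordinates with the measurement. -/
noncomputable def crossCov {E : Type*} [MeasurableSpace E] (f : ℝ → E → ℝ) (ζ : Measure ℝ)
    (η : Measure E) {n : ℕ} (x : EuclideanSpace ℝ (Fin n)) : Matrix (Fin n) (Fin n) ℝ :=
  fun j l => cov[fun p => p.1 j * p.1 l, fun p => measurement f x p.1 p.2; copiesLaw ζ η n]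

lemma crossCov_comm {E : Type*} [MeasurableSpace E] (f : ℝ → E → ℝ) (ζ : Measure ℝ)
    (η : Measure E) {n : ℕ} (x : EuclideanSpace ℝ (Fin n)) (j l : Fin n) :
    crossCov f ζ η x j l = crossCov f ζ η x l j := by
  simp only [crossCov, mul_comm]

section CrossCov

variable {ζ : Measure ℝ} {K : ℝ≥0} {E : Type*} [MeasurableSpace E] {η : Measure E}
  [IsProbabilityMeasure η]
  {n k : ℕ} {x : EuclideanSpace ℝ (Fin n)} {g : Fin k → Fin n} {c : Fin k → ℝ}
  {f : ℝ → E → ℝ}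

/-- Since E a_j a_l = δ_jl, subtracting the identity centers the product, which turns the
expectation into a covariance. -/
lemma integral_measurement_mul (h : IsCoordinateLaw ζ K)
    (hf : Measurable (Function.uncurry f)) (hx : IsSignedSupport x g c)
    (hψ : psiNorm 1 (linkValue f k) (copiesLaw ζ η k) ≤ K) (j l : Fin n) :
    Integrable (fun p => measurement f x p.1 p.2 * (p.1 j * p.1 l - (1 : Matrix _ _ ℝ) j l))
        (copiesLaw ζ η n) ∧
      ∫ p, measurement f x p.1 p.2 * (p.1 j * p.1 l - (1 : Matrix _ _ ℝ) j l)
        ∂(copiesLaw ζ η n) = crossCov f ζ η x j l := by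
  have := h.isProbabilityMeasure
  have := isProbabilityMeasure_copiesLaw (ζ := ζ) (η := η) n
  have h1 := memLp_measurement h hf hx hψ
  have h2 := h.memLp_mul (η := η) j l
  have hi : Integrable (fun p : (Fin n → ℝ) × E => measurement f x p.1 p.2 * (p.1 j * p.1 l))
      (copiesLaw ζ η n) := h1.integrable_mul h2
  have hi' := (h1.integrable (by norm_num)).mul_const ((1 : Matrix (Fin n) (Fin n) ℝ) j l)
  simp only [mul_sub]
  refine ⟨hi.sub hi', ?_⟩
  rw [integral_sub hi hi', crossCov, covariance_eq_sub h2 h1, h.integral_mul, integral_mul_const,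
    Matrix.one_apply, mul_comm (if j = l then (1 : ℝ) else 0)]
  congr 2
  ext p
  simp [mul_comm]

lemma crossCov_apply_range (h : IsCoordinateLaw ζ K)
    (hf : Measurable (Function.uncurry f)) (hx : IsSignedSupport x g c) (i l : Fin k) :
    crossCov f ζ η x (g i) (g l) = c i * c l *
      cov[fun p : (Fin k → ℝ) × E => p.1 i * p.1 l, linkValue f k; copiesLaw ζ η k] := by
  rw [covariance_comp_of_measurePreserving
    (h.measurePreserving_signed (η := η) hx.injective hx.sign) (by fun_prop)
    (measurable_linkValue hf k)]
  simp only [crossCov, hx.measurement_eq f]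
  rw [← covariance_const_mul_left]
  congr 1
  ext p
  linear_combination (-(p.1 (g i) * p.1 (g l)) * c l * c l) * hx.sign_sq i -
    (p.1 (g i) * p.1 (g l)) * hx.sign_sq l

/-- Exchangeability: the link value depends on the copies only through their sum. -/
lemma covariance_linkValue_perm (h : IsCoordinateLaw ζ K)
    (hf : Measurable (Function.uncurry f)) (σ : Equiv.Perm (Fin k)) (i l : Fin k) :
    cov[fun p : (Fin k → ℝ) × E => p.1 (σ i) * p.1 (σ l), linkValue f k; copiesLaw ζ η k] =
      cov[fun p : (Fin k → ℝ) × E => p.1 i * p.1 l, linkValue f k; copiesLaw ζ η k] := by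
  conv_rhs => rw [covariance_comp_of_measurePreserving
    (h.measurePreserving_signed (η := η) (c := fun _ => 1) σ.injective (fun _ => Or.inl rfl))
    (by fun_prop) (measurable_linkValue hf k)]
  have h2 : (fun p : (Fin k → ℝ) × E => linkValue f k ((fun i => 1 * p.1 (σ i) : Fin k → ℝ), p.2))
      = linkValue f k := by
    ext p
    unfold linkValue scaledMean mean
    simp only [one_mul]
    rw [Equiv.sum_comp σ p.1]
  rw [h2]
  simp only [one_mul]

lemma exists_perm_of_ne {i l i' l' : Fin k} (h : i ≠ l) (h' : i' ≠ l') :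
    ∃ σ : Equiv.Perm (Fin k), σ i = i' ∧ σ l = l' := by
  have hne : Equiv.swap i i' l ≠ i' := by
    intro he
    have : Equiv.swap i i' l = Equiv.swap i i' i := by rw [he, Equiv.swap_apply_left]
    exact h ((Equiv.swap i i').injective this).symm
  refine ⟨(Equiv.swap i i').trans (Equiv.swap (Equiv.swap i i' l) l'), ?_, ?_⟩
  · simp [Equiv.swap_apply_of_ne_of_ne hne.symm h']
  · simp

/-- Permutations act transitively on diagonal positions and on off-diagonal ones, so two values
remain. For k = 1 there is no off-diagonal position; β is then free and set to γ, since σ carries no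
sign information in that case. -/
lemma exists_covariance_linkValue_eq (h : IsCoordinateLaw ζ K)
    (hf : Measurable (Function.uncurry f)) (hk : 0 < k) :
    ∃ β γ : ℝ, (k = 1 → γ = β) ∧ ∀ i l : Fin k,
      cov[fun p : (Fin k → ℝ) × E => p.1 i * p.1 l, linkValue f k; copiesLaw ζ η k] =
        β + if i = l then γ - β else 0 := by
  set N : Fin k → Fin k → ℝ := fun i l =>
    cov[fun p : (Fin k → ℝ) × E => p.1 i * p.1 l, linkValue f k; copiesLaw ζ η k] with hN
  have hperm : ∀ (σ : Equiv.Perm (Fin k)) i l, N (σ i) (σ l) = N i l := fun σ i l =>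
    covariance_linkValue_perm h hf σ i l
  let i0 : Fin k := ⟨0, hk⟩
  have hdiag : ∀ i, N i i = N i0 i0 := by
    intro i
    have := hperm (Equiv.swap i0 i) i0 i0
    rwa [Equiv.swap_apply_left] at this
  rcases Nat.lt_or_ge 1 k with h1 | h1
  · let i1 : Fin k := ⟨1, h1⟩
    have hi : i0 ≠ i1 := by simp [i0, i1]
    refine ⟨N i0 i1, N i0 i0, fun hk1 => by omega, fun i l => ?_⟩
    split_ifs with hil
    · subst hil; rw [add_sub_cancel]; exact hdiag i
    · obtain ⟨σ, rfl, rfl⟩ := exists_perm_of_ne hi hil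
      rw [add_zero]; exact hperm σ i0 i1
  · have hk1 : k = 1 := by omega
    refine ⟨N i0 i0, N i0 i0, fun _ => rfl, fun i l => ?_⟩
    have : i = l := by subst hk1; exact Subsingleton.elim _ _
    subst this
    simpa using hdiag i

end CrossCov

lemma scaledMean_sq {E : Type*} {k : ℕ} (p : (Fin k → ℝ) × E) :
    scaledMean k p ^ 2 = (k : ℝ)⁻¹ * ∑ i, ∑ l, p.1 i * p.1 l := by
  rw [scaledMean, mean, mul_pow, Real.sq_sqrt (Nat.cast_nonneg k), div_pow,
    ← Finset.sum_mul_sum, ← sq]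
  rcases Nat.eq_zero_or_pos k with rfl | hk
  · simp
  · have : (k : ℝ) ≠ 0 := by exact_mod_cast hk.ne'
    field_simp

lemma residualSq_eq {E : Type*} {k : ℕ} (hk : 0 < k) (p : (Fin k → ℝ) × E) :
    residualSq p.1 = ∑ i, p.1 i * p.1 i - scaledMean k p ^ 2 := by
  have hk' : (k : ℝ) ≠ 0 := by exact_mod_cast hk.ne'
  rw [scaledMean, mul_pow, Real.sq_sqrt (Nat.cast_nonneg k), residualSq]
  have h1 : ∑ i, p.1 i = k * mean p.1 := by rw [mean]; field_simp
  have h2 : ∀ i, (p.1 i - mean p.1) ^ 2 =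
      p.1 i * p.1 i - p.1 i * (2 * mean p.1) + mean p.1 ^ 2 := fun i => by ring
  simp only [h2, Finset.sum_add_distrib, Finset.sum_sub_distrib, ← Finset.sum_mul, h1,
    Finset.sum_const, Finset.card_univ, Fintype.card_fin, nsmul_eq_mul]
  ring

/-! ### The mean matrix on and off the support. -/

section CrossCovStructure

variable {ζ : Measure ℝ} {K : ℝ≥0} {E : Type*} [MeasurableSpace E] {η : Measure E}
  [IsProbabilityMeasure η]
  {n k : ℕ} {x : EuclideanSpace ℝ (Fin n)} {g : Fin k → Fin n} {c : Fin k → ℝ}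
  {f : ℝ → E → ℝ}

/-- The measurement ignores coordinate j. On the diagonal, resampling that coordinate leaves the
factor E(z² - 1) = 0; off the diagonal, flipping its sign negates the covariance. -/
lemma crossCov_eq_zero (h : IsCoordinateLaw ζ K)
    (hf : Measurable (Function.uncurry f)) (hx : IsSignedSupport x g c)
    (hψ : psiNorm 1 (linkValue f k) (copiesLaw ζ η k) ≤ K) {j : Fin n}
    (hj : j ∉ Set.range g) (l : Fin n) : crossCov f ζ η x j l = 0 := by
  have := h.isProbabilityMeasure
  have := isProbabilityMeasure_copiesLaw (ζ := ζ) (η := η) n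
  have hmy := measurable_measurement hf x
  by_cases hjl : j = l
  · subst hjl
    rw [← (integral_measurement_mul h hf hx hψ j j).2]
    have hmp := measurePreserving_update (ζ := ζ) (η := η) j
    conv_lhs => rw [← hmp.map_eq]
    rw [integral_map hmp.measurable.aemeasurable (by fun_prop)]
    simp only [hx.measurement_update f hj, Function.update_self]
    rw [integral_prod_mul (fun p : (Fin n → ℝ) × E => measurement f x p.1 p.2)
      (fun z : ℝ => z * z - (1 : Matrix (Fin n) (Fin n) ℝ) j j)]
    simp only [← sq, Matrix.one_apply_eq]
    rw [integral_sub h.integrable_sq (integrable_const 1), h.integral_sq]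
    simp
  · have hmp := h.measurePreserving_signed (η := η) (g := id) (Function.injective_id (α := Fin n))
      (c := fun i => if i = j then -1 else 1) (fun i => by by_cases hi : i = j <;> simp [hi])
    have h1 : crossCov f ζ η x j l = -crossCov f ζ η x j l := by
      conv_lhs => rw [crossCov, covariance_comp_of_measurePreserving hmp (by fun_prop) hmy]
      rw [crossCov, ← covariance_fun_neg_left]
      congr 1
      · ext p
        simp [Ne.symm hjl]
      · ext p
        rw [← hx.measurement_update f hj p.1 (-p.1 j)]
        congr 1
        ext i
        by_cases hi : i = j
        · subst hi; simp
        · simp [hi]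
    linarith

lemma memLp_linkValue (h : IsCoordinateLaw ζ K) (hf : Measurable (Function.uncurry f))
    (hψ : psiNorm 1 (linkValue f k) (copiesLaw ζ η k) ≤ K) :
    MemLp (linkValue f k) 2 (copiesLaw ζ η k) := by
  have := h.isProbabilityMeasure
  have := isProbabilityMeasure_copiesLaw (ζ := ζ) (η := η) k
  have hm := measurable_linkValue hf k
  rw [memLp_two_iff_integrable_sq hm.aestronglyMeasurable]
  have h1 := lintegral_exp_rpow_le_of_psiNorm_le zero_le_one hψ
  simp only [Real.rpow_one] at h1
  have h2 := integrable_and_integral_le (hm.abs.pow_const 2) (fun p => by positivity)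
    (by positivity) (lintegral_abs_pow_le (by positivity) h1 2)
  simpa only [sq_abs] using h2.1

lemma memLp_sum_sum (h : IsCoordinateLaw ζ K) :
    MemLp (fun p : (Fin k → ℝ) × E => ∑ i, ∑ l, p.1 i * p.1 l) 2 (copiesLaw ζ η k) :=
  memLp_finsetSum _ fun i _ => memLp_finsetSum _ fun l _ => h.memLp_mul i l

/-- `μ` and `σ` in terms of the covariances of the products of two copies with the link value. -/
lemma muCov_eq_and_sigmaCov_eq (h : IsCoordinateLaw ζ K) (hf : Measurable (Function.uncurry f))
    (hk : 0 < k) (hψ : psiNorm 1 (linkValue f k) (copiesLaw ζ η k) ≤ K) {β γ : ℝ}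
    (hβγ : ∀ i l : Fin k,
      cov[fun p : (Fin k → ℝ) × E => p.1 i * p.1 l, linkValue f k; copiesLaw ζ η k] =
        β + if i = l then γ - β else 0) :
    muCov f ζ η k = k * β + (γ - β) ∧ sigmaCov f ζ η k = (k - 1) * (γ - β) := by
  have := h.isProbabilityMeasure
  have := isProbabilityMeasure_copiesLaw (ζ := ζ) (η := η) k
  have hy := memLp_linkValue h hf hψ
  have hk' : (k : ℝ) ≠ 0 := by exact_mod_cast hk.ne'
  have hmu : muCov f ζ η k = k * β + (γ - β) := by
    simp only [muCov, scaledMean_sq]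
    rw [covariance_const_mul_left, covariance_fun_sum_left
      (fun i => memLp_finsetSum _ fun l _ => h.memLp_mul i l) hy]
    have : ∀ i, cov[fun p : (Fin k → ℝ) × E => ∑ l, p.1 i * p.1 l, linkValue f k;
        copiesLaw ζ η k] = k * β + (γ - β) := by
      intro i
      rw [covariance_fun_sum_left (fun l => h.memLp_mul i l) hy]
      simp only [hβγ, Finset.sum_add_distrib, Finset.sum_ite_eq, Finset.mem_univ, if_true,
        Finset.sum_const, Finset.card_univ, Fintype.card_fin, nsmul_eq_mul]
    simp only [this, Finset.sum_const, Finset.card_univ, Fintype.card_fin, nsmul_eq_mul]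
    field_simp
  refine ⟨hmu, ?_⟩
  have h1 : MemLp (fun p : (Fin k → ℝ) × E => scaledMean k p ^ 2) 2 (copiesLaw ζ η k) := by
    simp only [scaledMean_sq]
    exact (memLp_sum_sum h).const_mul _
  have h2 : MemLp (fun p : (Fin k → ℝ) × E => ∑ i, p.1 i * p.1 i) 2 (copiesLaw ζ η k) :=
    memLp_finsetSum _ fun i _ => h.memLp_mul i i
  simp only [sigmaCov, residualSq_eq hk]
  rw [covariance_fun_sub_left h2 h1 hy,
    covariance_fun_sum_left (fun i => h.memLp_mul i i) hy]
  have h3 : cov[fun p : (Fin k → ℝ) × E => scaledMean k p ^ 2, linkValue f k; copiesLaw ζ η k] =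
      k * β + (γ - β) := hmu
  rw [h3]
  simp only [hβγ, if_true, Finset.sum_const, Finset.card_univ, Fintype.card_fin, nsmul_eq_mul]
  ring

lemma IsSignedSupport.quadraticForm_eq (hx : IsSignedSupport x g c)
    (X : Matrix (Fin n) (Fin n) ℝ) :
    x.ofLp ⬝ᵥ X *ᵥ x.ofLp = (k : ℝ)⁻¹ * ∑ i, ∑ l, X (g i) (g l) * (c i * c l) := by
  have h1 : ∀ j, (X *ᵥ x.ofLp) j = ∑ l, X j (g l) * x (g l) := fun j =>
    hx.sum_mul (fun l => X j l) id rfl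
  have h2 := hx.sum_mul (fun j => (X *ᵥ x.ofLp) j) id rfl
  simp only [id] at h2
  rw [dotProduct_comm]
  refine h2.trans ?_
  have hsq : √(k : ℝ) * √(k : ℝ) = k := Real.mul_self_sqrt (Nat.cast_nonneg k)
  have hk := hx.sqrt_pos
  simp only [h1, Finset.sum_mul, Finset.mul_sum]
  refine Finset.sum_congr rfl fun i _ => Finset.sum_congr rfl fun l _ => ?_
  have hinv : (k : ℝ)⁻¹ = (√(k : ℝ))⁻¹ * (√(k : ℝ))⁻¹ := by rw [← mul_inv, hsq]
  rw [hx.apply, hx.apply, hinv]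
  ring

/-- The mean of the sample matrix is `μ x xᵀ`, up to a term that only penalizes matrices that
differ from `x xᵀ` on the support. -/
lemma crossCov_quadraticForm (h : IsCoordinateLaw ζ K) (hf : Measurable (Function.uncurry f))
    (hx1 : ‖x‖ = 1) (hx : IsSignedSupport x g c)
    (hψ : psiNorm 1 (linkValue f k) (copiesLaw ζ η k) ≤ K) (hσ : sigmaCov f ζ η k ≤ 0) :
    (∀ X : Matrix (Fin n) (Fin n) ℝ, X.PosSemidef → (Xᵀ * crossCov f ζ η x).trace ≤
      muCov f ζ η k * (x.ofLp ⬝ᵥ X *ᵥ x.ofLp)) ∧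
    ((Matrix.vecMulVec x.ofLp x.ofLp)ᵀ * crossCov f ζ η x).trace = muCov f ζ η k := by
  obtain ⟨β, γ, h1, hβγ⟩ := exists_covariance_linkValue_eq (ζ := ζ) (η := η) h hf hx.pos
  obtain ⟨hmu, hsi⟩ := muCov_eq_and_sigmaCov_eq h hf hx.pos hψ hβγ
  have hk' : (k : ℝ) ≠ 0 := by exact_mod_cast hx.pos.ne'
  have hle : γ - β ≤ 0 := by
    rcases Nat.lt_or_ge 1 k with hk | hk
    · rw [hsi] at hσ
      have : (0 : ℝ) < k - 1 := by
        have : (1 : ℝ) < k := by exact_mod_cast hk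
        linarith
      by_contra hcon
      push Not at hcon
      nlinarith [mul_pos this hcon]
    · rw [h1 (by have := hx.pos; omega), sub_self]
  -- This is the decomposition of the mean as kβ xxᵀ plus γ - β times the projection onto the
  -- support, paired with X.
  have htr : ∀ X : Matrix (Fin n) (Fin n) ℝ, (Xᵀ * crossCov f ζ η x).trace =
      k * β * (x.ofLp ⬝ᵥ X *ᵥ x.ofLp) + (γ - β) * (X.submatrix g g).trace := by
    intro X
    rw [trace_transpose_mul_eq_sum, hx.quadraticForm_eq]
    have e1 : ∑ j, ∑ l, X j l * crossCov f ζ η x j l =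
        ∑ i, ∑ l, X (g i) (g l) * crossCov f ζ η x (g i) (g l) := by
      have e2 : ∀ F : Fin n → ℝ, (∀ j ∉ Set.range g, F j = 0) → ∑ j, F j = ∑ i, F (g i) := by
        intro F hF
        rw [← Finset.sum_image (s := Finset.univ) (g := g) (f := F)
          (fun a _ b _ hab => hx.injective hab)]
        symm
        exact Finset.sum_subset (Finset.subset_univ _) fun j _ hj => hF j (by simpa using hj)
      rw [e2]
      · refine Finset.sum_congr rfl fun i _ => e2 _ fun j hj => ?_
        rw [crossCov_comm, crossCov_eq_zero h hf hx hψ hj, mul_zero]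
      · intro j hj
        simp only [crossCov_eq_zero h hf hx hψ hj, mul_zero, Finset.sum_const_zero]
    rw [e1]
    simp only [crossCov_apply_range h hf hx, hβγ, mul_add, mul_ite, mul_zero,
      Finset.sum_add_distrib, Finset.sum_ite_eq, Finset.mem_univ, if_true, hx.sign_sq, one_mul]
    have e3 : ∀ S : ℝ, (k : ℝ) * β * ((k : ℝ)⁻¹ * S) = β * S := fun S => by field_simp
    rw [e3, Matrix.trace, Finset.mul_sum, Finset.mul_sum]
    congr 1
    · refine Finset.sum_congr rfl fun i _ => ?_
      rw [Finset.mul_sum]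
      refine Finset.sum_congr rfl fun l _ => ?_
      ring
    · refine Finset.sum_congr rfl fun i _ => ?_
      simp only [Matrix.diag_apply, Matrix.submatrix_apply]
      ring
  have hxx : ∑ i, x (g i) * x (g i) = 1 := by
    have := sum_sq_eq_norm_sq x
    rw [hx1, one_pow] at this
    rw [← this]
    simp only [sq]
    exact (hx.sum_mul x.ofLp id rfl).symm
  constructor
  · intro X hX
    rw [htr, hmu]
    -- The trace over the support dominates xᵀXx; multiplied by γ - β ≤ 0 this becomes the required
    -- upper bound.
    have h2 := dotProduct_mulVec_le_trace (hX.submatrix g) (fun i => x (g i))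
    have h3 : (fun i => x (g i)) ⬝ᵥ (X.submatrix g g) *ᵥ (fun i => x (g i)) =
        x.ofLp ⬝ᵥ X *ᵥ x.ofLp := by
      have e3 := hx.sum_mul (fun j => (X *ᵥ x.ofLp) j) id rfl
      rw [dotProduct_comm x.ofLp, dotProduct_comm]
      refine Eq.trans ?_ e3.symm
      refine Finset.sum_congr rfl fun i _ => ?_
      simp only [id]
      congr 1
      exact (hx.sum_mul (fun l => X (g i) l) id rfl).symm
    have h4 : (fun i => x (g i)) ⬝ᵥ (fun i => x (g i)) = 1 := hxx
    rw [h3, h4, mul_one] at h2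
    nlinarith
  · rw [htr, hmu]
    have h5 : ((Matrix.vecMulVec x.ofLp x.ofLp).submatrix g g).trace = 1 := hxx
    have h6 : x.ofLp ⬝ᵥ x.ofLp = 1 := by
      have := sum_sq_eq_norm_sq x
      rw [hx1] at this
      simpa [dotProduct, sq] using this
    rw [h5, Matrix.vecMulVec_mulVec, h6]
    simp [h6]

end CrossCovStructure

/-! ### Exponential moments of the entries -/

/-- The measurement, set to zero where it exceeds the level `B`. -/
noncomputable def truncatedMeasurement {E : Type*} {n : ℕ} (f : ℝ → E → ℝ) (x : EuclideanSpace ℝ (Fin n)) (B : ℝ)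
    (p : (Fin n → ℝ) × E) : ℝ :=
  if |measurement f x p.1 p.2| ≤ B then measurement f x p.1 p.2 else 0

lemma abs_truncatedMeasurement_le {E : Type*} {n : ℕ} {f : ℝ → E → ℝ}
    {x : EuclideanSpace ℝ (Fin n)} {B : ℝ} (hB : 0 ≤ B) (p : (Fin n → ℝ) × E) :
    |truncatedMeasurement f x B p| ≤ B := by
  unfold truncatedMeasurement
  split_ifs with h
  · exact h
  · simpa using hB

lemma IsSignedSupport.truncatedMeasurement_update {E : Type*} {n k : ℕ}
    {f : ℝ → E → ℝ} {x : EuclideanSpace ℝ (Fin n)} {g : Fin k → Fin n} {c : Fin k → ℝ}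
    (hx : IsSignedSupport x g c) (B : ℝ)
    {j : Fin n} (hj : j ∉ Set.range g) (p : (Fin n → ℝ) × E) (z : ℝ) :
    truncatedMeasurement f x B (Function.update p.1 j z, p.2) = truncatedMeasurement f x B p := by
  simp only [truncatedMeasurement, hx.measurement_update f hj]

section ExponentialMoments

variable {ζ : Measure ℝ} {K : ℝ≥0} {E : Type*} [MeasurableSpace E] {η : Measure E}
  [IsProbabilityMeasure η]
  {n k : ℕ} {x : EuclideanSpace ℝ (Fin n)} {g : Fin k → Fin n} {c : Fin k → ℝ}
  {f : ℝ → E → ℝ}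

/-- By `exp_sub_sq_le`, E exp(λX - λ²X²) ≤ 1 + λ E X + λ² E X², at most the exponential of λ E X +
λ² E X². Dividing by that exponential is the remaining part of the exponent. -/
lemma lintegral_exp_sub_sq_le {Ω : Type*} [MeasurableSpace Ω] {P : Measure Ω}
    [IsProbabilityMeasure P] {X : Ω → ℝ} (hX : Integrable X P)
    (hX2 : Integrable (fun ω => X ω ^ 2) P) (lam : ℝ) :
    ∫⁻ ω, ENNReal.ofReal (Real.exp (lam * (X ω - ∫ ω, X ω ∂P) -
      lam ^ 2 * (X ω ^ 2 + ∫ ω, X ω ^ 2 ∂P))) ∂P ≤ 1 := by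
  set a := ∫ ω, X ω ∂P
  set b := ∫ ω, X ω ^ 2 ∂P
  have hg : Integrable (fun ω => 1 + lam * X ω + lam ^ 2 * X ω ^ 2) P :=
    ((integrable_const 1).add (hX.const_mul lam)).add (hX2.const_mul _)
  have hle : ∀ ω, Real.exp (lam * X ω - (lam * X ω) ^ 2) ≤
      1 + lam * X ω + lam ^ 2 * X ω ^ 2 := fun ω =>
    (exp_sub_sq_le (lam * X ω)).trans (le_of_eq (by ring))
  have h0 : ∀ ω, 0 ≤ 1 + lam * X ω + lam ^ 2 * X ω ^ 2 := fun ω =>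
    (Real.exp_pos _).le.trans (hle ω)
  calc ∫⁻ ω, ENNReal.ofReal (Real.exp (lam * (X ω - a) - lam ^ 2 * (X ω ^ 2 + b))) ∂P
      ≤ ∫⁻ ω, ENNReal.ofReal (Real.exp (-(lam * a + lam ^ 2 * b))) *
          ENNReal.ofReal (1 + lam * X ω + lam ^ 2 * X ω ^ 2) ∂P := by
        refine lintegral_mono fun ω => ?_
        rw [← ENNReal.ofReal_mul (by positivity)]
        refine ENNReal.ofReal_le_ofReal ?_
        have e : lam * (X ω - a) - lam ^ 2 * (X ω ^ 2 + b) =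
            -(lam * a + lam ^ 2 * b) + (lam * X ω - (lam * X ω) ^ 2) := by ring
        rw [e, Real.exp_add]
        exact mul_le_mul_of_nonneg_left (hle ω) (Real.exp_pos _).le
    _ = ENNReal.ofReal (Real.exp (-(lam * a + lam ^ 2 * b))) *
          ENNReal.ofReal (1 + lam * a + lam ^ 2 * b) := by
        rw [lintegral_const_mul' _ _ ENNReal.ofReal_ne_top,
          ← ofReal_integral_eq_lintegral_ofReal hg (Filter.Eventually.of_forall h0)]
        congr 2
        have i1 : Integrable (fun ω => 1 + lam * X ω) P :=
          (integrable_const 1).add (hX.const_mul lam)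
        rw [integral_add i1 (hX2.const_mul _),
          integral_add (integrable_const 1) (hX.const_mul lam), integral_const_mul,
          integral_const_mul]
        simp [a, b]
    _ ≤ 1 := by
        rw [← ENNReal.ofReal_mul (by positivity), ← ENNReal.ofReal_one]
        refine ENNReal.ofReal_le_ofReal ?_
        have h1 := Real.add_one_le_exp (lam * a + lam ^ 2 * b)
        calc Real.exp (-(lam * a + lam ^ 2 * b)) * (1 + lam * a + lam ^ 2 * b)
            ≤ Real.exp (-(lam * a + lam ^ 2 * b)) * Real.exp (lam * a + lam ^ 2 * b) := by
              gcongr; linarith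
          _ = 1 := by rw [← Real.exp_add]; simp

lemma measurable_truncatedMeasurement (hf : Measurable (Function.uncurry f)) (B : ℝ) :
    Measurable (truncatedMeasurement f x B) := by
  have hm := measurable_measurement hf x
  exact Measurable.ite (measurableSet_le hm.abs measurable_const) hm measurable_const

lemma ofReal_exp_add (a b : ℝ) : ENNReal.ofReal (Real.exp (a + b)) =
    ENNReal.ofReal (Real.exp a) * ENNReal.ofReal (Real.exp b) := by
  rw [Real.exp_add, ENNReal.ofReal_mul (Real.exp_pos _).le]

/-- Entries outside the support. -/
lemma lintegral_exp_outside_le (h : IsCoordinateLaw ζ K) (hf : Measurable (Function.uncurry f))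
    (hx : IsSignedSupport x g c) {j l : Fin n} (hj : j ∉ Set.range g) (hl : l ∉ Set.range g)
    {B lam : ℝ} (hB : 0 ≤ B) (hlam : |lam| * B * (2 * ((K : ℝ) + 1) ^ 2) ≤ 1) :
    ∫⁻ p, ENNReal.ofReal (Real.exp
      (lam * (truncatedMeasurement f x B p * (p.1 j * p.1 l - (1 : Matrix _ _ ℝ) j l)) -
        lam ^ 2 * (48 * ((K : ℝ) + 1) ^ 4 * truncatedMeasurement f x B p ^ 2)))
      ∂(copiesLaw ζ η n) ≤ 1 := by
  have := h.isProbabilityMeasure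
  have := isProbabilityMeasure_copiesLaw (ζ := ζ) (η := η) n
  have hm := measurable_truncatedMeasurement (x := x) hf B
  set L : ℝ := (K : ℝ) + 1 with hL
  have hL1 : 1 ≤ L := by linarith [K.2]
  set Y := truncatedMeasurement f x B with hY
  have hθ : ∀ p, |lam * Y p| * (2 * L ^ 2) ≤ 1 := fun p => by
    rw [abs_mul]
    refine le_trans ?_ hlam
    gcongr
    exact abs_truncatedMeasurement_le hB p
  by_cases hjl : j = l
  · subst hjl
    rw [lintegral_eq_lintegral_update j (by fun_prop)]
    refine (lintegral_mono (g := fun _ => 1) fun p => ?_).trans (by simp)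
    simp only [hY, hx.truncatedMeasurement_update B hj, Function.update_self, Matrix.one_apply_eq]
    simp only [← hY]
    have e : ∀ z : ℝ, lam * (Y p * (z * z - 1)) - lam ^ 2 * (48 * L ^ 4 * Y p ^ 2) =
        lam * Y p * (z ^ 2 - 1) + -(48 * L ^ 4 * (lam * Y p) ^ 2) := fun z => by ring
    simp only [e, ofReal_exp_add]
    rw [lintegral_mul_const' _ _ ENNReal.ofReal_ne_top]
    calc _ ≤ ENNReal.ofReal (Real.exp (48 * L ^ 4 * (lam * Y p) ^ 2)) *
          ENNReal.ofReal (Real.exp (-(48 * L ^ 4 * (lam * Y p) ^ 2))) := by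
          gcongr
          exact h.lintegral_exp_mul_sq_sub_one_le (hθ p)
      _ = 1 := by rw [← ofReal_exp_add]; simp
  -- Averaging over a_l leaves exp(L²(λY a_j)²), and averaging that over a_j needs L⁴(λY)² ≤ 1. This
  -- is where the truncation of Y enters; the result is within the allowance 48L⁴(λY)².
  · rw [lintegral_eq_lintegral_update l (by fun_prop)]
    simp only [hY, hx.truncatedMeasurement_update B hl, Function.update_self,
      Function.update_of_ne hjl, Matrix.one_apply_ne hjl, sub_zero]
    simp only [← hY]
    have e : ∀ (p : (Fin n → ℝ) × E) (z : ℝ),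
        lam * (Y p * (p.1 j * z)) - lam ^ 2 * (48 * L ^ 4 * Y p ^ 2) =
        lam * Y p * p.1 j * z + -(48 * L ^ 4 * (lam * Y p) ^ 2) := fun p z => by ring
    simp only [e, ofReal_exp_add]
    have h1 : ∀ p : (Fin n → ℝ) × E,
        ∫⁻ z, ENNReal.ofReal (Real.exp (lam * Y p * p.1 j * z)) *
          ENNReal.ofReal (Real.exp (-(48 * L ^ 4 * (lam * Y p) ^ 2))) ∂ζ ≤
        ENNReal.ofReal (Real.exp (L ^ 2 * (lam * Y p * p.1 j) ^ 2)) *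
          ENNReal.ofReal (Real.exp (-(48 * L ^ 4 * (lam * Y p) ^ 2))) := fun p => by
      rw [lintegral_mul_const' _ _ ENNReal.ofReal_ne_top]
      gcongr
      exact h.lintegral_exp_mul_le _
    refine (lintegral_mono h1).trans ?_
    rw [lintegral_eq_lintegral_update j (by fun_prop)]
    refine (lintegral_mono (g := fun _ => 1) fun p => ?_).trans (by simp)
    simp only [hY, hx.truncatedMeasurement_update B hj, Function.update_self]
    simp only [← hY]
    have e2 : ∀ z : ℝ, L ^ 2 * (lam * Y p * z) ^ 2 = (L ^ 2 * (lam * Y p) ^ 2) * z ^ 2 :=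
      fun z => by ring
    simp only [e2]
    rw [lintegral_mul_const' _ _ ENNReal.ofReal_ne_top]
    have h2 : L ^ 2 * (lam * Y p) ^ 2 * L ^ 2 ≤ 1 := by
      have h3 := hθ p
      have h4 : |lam * Y p| * L ^ 2 ≤ 1 := by nlinarith [abs_nonneg (lam * Y p), sq_nonneg L]
      have h5 : (|lam * Y p| * L ^ 2) ^ 2 ≤ 1 := pow_le_one₀ (by positivity) h4
      rw [mul_pow, sq_abs] at h5
      linarith
    calc _ ≤ ENNReal.ofReal (Real.exp (L ^ 2 * (lam * Y p) ^ 2 * L ^ 2)) *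
          ENNReal.ofReal (Real.exp (-(48 * L ^ 4 * (lam * Y p) ^ 2))) := by
          gcongr
          exact h.lintegral_exp_mul_sq_le (by positivity) h2
      _ ≤ 1 := by
          rw [← ofReal_exp_add, ← ENNReal.ofReal_one]
          refine ENNReal.ofReal_le_ofReal (Real.exp_le_one_iff.2 ?_)
          have : 0 ≤ L ^ 4 * (lam * Y p) ^ 2 := by positivity
          nlinarith

/-- Entries with one index outside the support. -/
lemma lintegral_exp_mixed_le (h : IsCoordinateLaw ζ K) (hf : Measurable (Function.uncurry f))
    (hx : IsSignedSupport x g c) {j l : Fin n} (hj : j ∈ Set.range g) (hl : l ∉ Set.range g)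
    (lam : ℝ) :
    ∫⁻ p, ENNReal.ofReal (Real.exp
      (lam * (measurement f x p.1 p.2 * (p.1 j * p.1 l - (1 : Matrix _ _ ℝ) j l)) -
        lam ^ 2 * (((K : ℝ) + 1) ^ 2 * (measurement f x p.1 p.2 ^ 2 * p.1 j ^ 2))))
      ∂(copiesLaw ζ η n) ≤ 1 := by
  have := h.isProbabilityMeasure
  have := isProbabilityMeasure_copiesLaw (ζ := ζ) (η := η) n
  have hm := measurable_measurement hf x
  have hjl : j ≠ l := by rintro rfl; exact hl hj
  -- Given all else, the term is linear in the subgaussian a_l, so every λ is allowed and no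
  -- truncation is needed. The random coefficient y a_j goes into the proxy.
  rw [lintegral_eq_lintegral_update l (by fun_prop)]
  refine (lintegral_mono (g := fun _ => 1) fun p => ?_).trans (by simp)
  simp only [hx.measurement_update f hl, Function.update_self,
      Function.update_of_ne hjl, Matrix.one_apply_ne hjl, sub_zero]
  set L : ℝ := (K : ℝ) + 1 with hL
  set y := measurement f x p.1 p.2
  have e : ∀ z : ℝ, lam * (y * (p.1 j * z)) - lam ^ 2 * (L ^ 2 * (y ^ 2 * p.1 j ^ 2)) =
      lam * y * p.1 j * z + -(L ^ 2 * (lam * y * p.1 j) ^ 2) := fun z => by ring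
  simp only [e, ofReal_exp_add]
  rw [lintegral_mul_const' _ _ ENNReal.ofReal_ne_top]
  calc _ ≤ ENNReal.ofReal (Real.exp (L ^ 2 * (lam * y * p.1 j) ^ 2)) *
        ENNReal.ofReal (Real.exp (-(L ^ 2 * (lam * y * p.1 j) ^ 2))) := by
        gcongr
        exact h.lintegral_exp_mul_le _
    _ = 1 := by rw [← ofReal_exp_add]; simp

/-- The arithmetic-geometric mean inequality separates y from a_j, which are dependent on the
support. The cases r = 1 and r = 2 feed the mean and the variance in Chebyshev's inequality. -/
lemma sq_mul_pow_four_moment (h : IsCoordinateLaw ζ K) (hf : Measurable (Function.uncurry f))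
    (hx : IsSignedSupport x g c) (hψ : psiNorm 1 (linkValue f k) (copiesLaw ζ η k) ≤ K)
    (j : Fin n) {r : ℕ} (hr : r = 1 ∨ r = 2) :
    Integrable (fun p => (measurement f x p.1 p.2 ^ 2 * p.1 j ^ 4) ^ r) (copiesLaw ζ η n) ∧
      ∫ p, (measurement f x p.1 p.2 ^ 2 * p.1 j ^ 4) ^ r ∂(copiesLaw ζ η n) ≤
        momentBound K := by
  have hm := measurable_measurement hf x
  have hr' : 4 * r ≤ 8 := by rcases hr with rfl | rfl <;> norm_num
  obtain ⟨h1, h1'⟩ := measurement_moment h hf hx hψ hr'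
  obtain ⟨h2, h2'⟩ := h.coord_moment (η := η) j hr'
  set A := momentBound K
  have hle : ∀ p : (Fin n → ℝ) × E, (measurement f x p.1 p.2 ^ 2 * p.1 j ^ 4) ^ r ≤
      (|measurement f x p.1 p.2| ^ (4 * r) + (p.1 j ^ 2) ^ (4 * r)) / 2 := by
    intro p
    have e0 : (measurement f x p.1 p.2 ^ 2 * p.1 j ^ 4) ^ r =
        |measurement f x p.1 p.2| ^ (2 * r) * p.1 j ^ (4 * r) := by
      rw [mul_pow, ← sq_abs (measurement f x p.1 p.2), ← pow_mul, ← pow_mul]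
    have e1 : |measurement f x p.1 p.2| ^ (4 * r) = (|measurement f x p.1 p.2| ^ (2 * r)) ^ 2 := by
      rw [← pow_mul]; congr 1; ring
    have e2 : (p.1 j ^ 2) ^ (4 * r) = (p.1 j ^ (4 * r)) ^ 2 := by
      rw [← pow_mul, ← pow_mul, mul_comm]
    rw [e0, e1, e2]
    nlinarith [sq_nonneg (|measurement f x p.1 p.2| ^ (2 * r) - p.1 j ^ (4 * r))]
  have hdom : Integrable (fun p : (Fin n → ℝ) × E =>
      (|measurement f x p.1 p.2| ^ (4 * r) + (p.1 j ^ 2) ^ (4 * r)) / 2) (copiesLaw ζ η n) :=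
    (h1.add h2).div_const 2
  have hint : Integrable (fun p => (measurement f x p.1 p.2 ^ 2 * p.1 j ^ 4) ^ r)
      (copiesLaw ζ η n) := by
    refine hdom.mono' (by fun_prop) (Filter.Eventually.of_forall fun p => ?_)
    rw [Real.norm_of_nonneg (by positivity)]
    exact hle p
  refine ⟨hint, (integral_mono hint hdom hle).trans ?_⟩
  rw [integral_div, integral_add h1 h2]
  linarith

lemma sq_measurement_mul_le (y a b d : ℝ) (hd : d = 0 ∨ d = 1) :
    (y * (a * b - d)) ^ 2 ≤ y ^ 2 * a ^ 4 + y ^ 2 * b ^ 4 + 2 * y ^ 2 := by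
  have h1 : (a * b - d) ^ 2 ≤ a ^ 4 + b ^ 4 + 2 := by
    rcases hd with rfl | rfl <;>
    nlinarith [sq_nonneg (a * b + 1), sq_nonneg (a ^ 2 - b ^ 2), sq_nonneg (a * b),
      sq_nonneg (a ^ 2), sq_nonneg (b ^ 2)]
  rw [mul_pow]
  nlinarith [mul_le_mul_of_nonneg_left h1 (sq_nonneg y)]

lemma entry_sq_moment (h : IsCoordinateLaw ζ K) (hf : Measurable (Function.uncurry f))
    (hx : IsSignedSupport x g c) (hψ : psiNorm 1 (linkValue f k) (copiesLaw ζ η k) ≤ K)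
    (j l : Fin n) :
    Integrable (fun p =>
        (measurement f x p.1 p.2 * (p.1 j * p.1 l - (1 : Matrix _ _ ℝ) j l)) ^ 2)
        (copiesLaw ζ η n) ∧
      ∫ p, (measurement f x p.1 p.2 * (p.1 j * p.1 l - (1 : Matrix _ _ ℝ) j l)) ^ 2
        ∂(copiesLaw ζ η n) ≤ 4 * momentBound K := by
  have hm := measurable_measurement hf x
  obtain ⟨h1, h1'⟩ := sq_mul_pow_four_moment h hf hx hψ j (Or.inl rfl)
  obtain ⟨h2, h2'⟩ := sq_mul_pow_four_moment h hf hx hψ l (Or.inl rfl)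
  obtain ⟨h3, h3'⟩ := measurement_moment h hf hx hψ (q := 2) (by norm_num)
  simp only [pow_one] at h1 h1' h2 h2'
  simp only [sq_abs] at h3 h3'
  have hle := fun p : (Fin n → ℝ) × E => sq_measurement_mul_le (measurement f x p.1 p.2) (p.1 j)
    (p.1 l) ((1 : Matrix (Fin n) (Fin n) ℝ) j l) (by
      rw [Matrix.one_apply]; split_ifs <;> simp)
  have hdom := (h1.add h2).add (h3.const_mul 2)
  have hint : Integrable (fun p =>
      (measurement f x p.1 p.2 * (p.1 j * p.1 l - (1 : Matrix _ _ ℝ) j l)) ^ 2)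
        (copiesLaw ζ η n) := by
    refine hdom.mono' (by fun_prop) (Filter.Eventually.of_forall fun p => ?_)
    rw [Real.norm_of_nonneg (by positivity)]
    exact hle p
  refine ⟨hint, (integral_mono hint hdom hle).trans ?_⟩
  have e := integral_add (h1.add h2) (h3.const_mul 2)
  have e' := integral_add h1 h2
  simp only [Pi.add_apply] at e e' ⊢
  rw [e, e', integral_const_mul]
  linarith

/-- Entries inside the support. -/
lemma lintegral_exp_inside_le (h : IsCoordinateLaw ζ K) (hf : Measurable (Function.uncurry f))
    (hx : IsSignedSupport x g c) (hψ : psiNorm 1 (linkValue f k) (copiesLaw ζ η k) ≤ K)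
    (j l : Fin n) (lam : ℝ) :
    ∫⁻ p, ENNReal.ofReal (Real.exp
      (lam * (measurement f x p.1 p.2 * (p.1 j * p.1 l - (1 : Matrix _ _ ℝ) j l) -
          crossCov f ζ η x j l) -
        lam ^ 2 * ((measurement f x p.1 p.2 * (p.1 j * p.1 l - (1 : Matrix _ _ ℝ) j l)) ^ 2 +
          4 * momentBound K)))
      ∂(copiesLaw ζ η n) ≤ 1 := by
  have := h.isProbabilityMeasure
  have := isProbabilityMeasure_copiesLaw (ζ := ζ) (η := η) n
  obtain ⟨h1, h1'⟩ := integral_measurement_mul h hf hx hψ j l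
  obtain ⟨h2, h2'⟩ := entry_sq_moment h hf hx hψ j l
  refine le_trans ?_ (lintegral_exp_sub_sq_le h1 h2 lam)
  rw [h1']
  refine lintegral_mono fun p => ENNReal.ofReal_le_ofReal (Real.exp_le_exp.2 ?_)
  gcongr

end ExponentialMoments

/-! ### Sums over independent samples -/

section ProductTail

variable {S : Type*} [MeasurableSpace S] {ν : Measure S} [IsProbabilityMeasure ν] {m : ℕ}

lemma lintegral_pi_prod {F : S → ℝ≥0∞} (hF : Measurable F) :
    ∫⁻ w, ∏ i, F (w i) ∂(Measure.pi fun _ : Fin m => ν) = (∫⁻ p, F p ∂ν) ^ m := by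
  have hind : iIndepFun (fun (i : Fin m) (w : Fin m → S) => F (w i))
      (Measure.pi fun _ : Fin m => ν) :=
    iIndepFun_pi (X := fun _ p => F p) (fun _ => hF.aemeasurable)
  rw [lintegral_prod_eq_prod_lintegral_of_indepFun Finset.univ _ hind (fun i => by fun_prop)]
  have : ∀ i : Fin m, ∫⁻ w, F (w i) ∂(Measure.pi fun _ : Fin m => ν) = ∫⁻ p, F p ∂ν := fun i =>
    (measurePreserving_eval (fun _ : Fin m => ν) i).lintegral_comp hF
  simp [this]

/-- A self-normalized Chernoff bound. -/
lemma pi_measure_sum_ge_le {G H : S → ℝ} (hG : Measurable G) (hH : Measurable H) {lam : ℝ}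
    (hlam : 0 ≤ lam)
    (h : ∫⁻ p, ENNReal.ofReal (Real.exp (lam * G p - lam ^ 2 * H p)) ∂ν ≤ 1) (T R : ℝ) :
    (Measure.pi fun _ : Fin m => ν) {w | T ≤ ∑ i, G (w i) ∧ ∑ i, H (w i) ≤ R} ≤
      ENNReal.ofReal (Real.exp (-(lam * T) + lam ^ 2 * R)) := by
  set Φ : S → ℝ≥0∞ := fun p => ENNReal.ofReal (Real.exp (lam * G p - lam ^ 2 * H p)) with hΦ
  have hΦm : Measurable Φ := by fun_prop
  set e := ENNReal.ofReal (Real.exp (lam * T - lam ^ 2 * R)) with he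
  have he0 : e ≠ 0 := by simp [he, Real.exp_pos]
  have hprod : ∀ w : Fin m → S, ∏ i, Φ (w i) =
      ENNReal.ofReal (Real.exp (lam * ∑ i, G (w i) - lam ^ 2 * ∑ i, H (w i))) := fun w => by
    rw [Finset.mul_sum, Finset.mul_sum, ← Finset.sum_sub_distrib, Real.exp_sum,
      ENNReal.ofReal_prod_of_nonneg fun i _ => (Real.exp_pos _).le]
  -- On this event the random proxy is at most R, so the product, of expectation at most 1, is at
  -- least `e`; Markov's inequality applies.
  have hsub : {w : Fin m → S | T ≤ ∑ i, G (w i) ∧ ∑ i, H (w i) ≤ R} ⊆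
      {w | e ≤ ∏ i, Φ (w i)} := by
    rintro w ⟨h1, h2⟩
    simp only [Set.mem_ofPred_eq, hprod, he]
    refine ENNReal.ofReal_le_ofReal (Real.exp_le_exp.2 ?_)
    gcongr
  have hmark := mul_meas_ge_le_lintegral₀ (μ := Measure.pi fun _ : Fin m => ν)
    (f := fun w => ∏ i, Φ (w i))
    (Finset.measurable_fun_prod Finset.univ fun i _ =>
      hΦm.comp (measurable_pi_apply i)).aemeasurable e
  rw [lintegral_pi_prod hΦm] at hmark
  have h1 : e * (Measure.pi fun _ : Fin m => ν) {w | e ≤ ∏ i, Φ (w i)} ≤ 1 :=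
    hmark.trans (pow_le_one' h m)
  calc _ ≤ (Measure.pi fun _ : Fin m => ν) {w | e ≤ ∏ i, Φ (w i)} := measure_mono hsub
    _ = ENNReal.ofReal (Real.exp (-(lam * T) + lam ^ 2 * R)) *
          (e * (Measure.pi fun _ : Fin m => ν) {w | e ≤ ∏ i, Φ (w i)}) := by
        rw [← mul_assoc, he, ← ofReal_exp_add]
        simp
    _ ≤ _ := mul_le_of_le_one_right' h1

lemma pi_measure_abs_sum_ge_le {G H : S → ℝ} (hG : Measurable G) (hH : Measurable H) {lam : ℝ}
    (hlam : 0 ≤ lam)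
    (h : ∀ t : ℝ, |t| = lam →
      ∫⁻ p, ENNReal.ofReal (Real.exp (t * G p - t ^ 2 * H p)) ∂ν ≤ 1) (T R : ℝ) :
    (Measure.pi fun _ : Fin m => ν) {w | T ≤ |∑ i, G (w i)| ∧ ∑ i, H (w i) ≤ R} ≤
      2 * ENNReal.ofReal (Real.exp (-(lam * T) + lam ^ 2 * R)) := by
  have h1 := pi_measure_sum_ge_le (m := m) hG hH hlam (h lam (abs_of_nonneg hlam)) T R
  have h2 := pi_measure_sum_ge_le (m := m) (G := fun p => -G p) hG.neg hH hlam (by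
    have := h (-lam) (by rw [abs_neg, abs_of_nonneg hlam])
    simpa only [neg_mul, mul_neg, even_two, Even.neg_pow] using this) T R
  refine (measure_mono (t := {w | T ≤ ∑ i, G (w i) ∧ ∑ i, H (w i) ≤ R} ∪
    {w | T ≤ ∑ i, -G (w i) ∧ ∑ i, H (w i) ≤ R}) ?_).trans ?_
  · rintro w ⟨hw, hw'⟩
    rcases le_abs.1 hw with h3 | h3
    · exact Or.inl ⟨h3, hw'⟩
    · exact Or.inr ⟨by rwa [Finset.sum_neg_distrib], hw'⟩
  · rw [two_mul]
    exact (measure_union_le _ _).trans (add_le_add h1 h2)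

/-- Chebyshev's inequality for a sum of independent copies of a nonnegative variable. -/
lemma pi_measure_sum_gt_le {U : S → ℝ} (hU : Measurable U)
    {A : ℝ} (hA : 1 ≤ A) (hm : 0 < m) (hi2 : Integrable (fun p => U p ^ 2) ν)
    (h1 : ∫ p, U p ∂ν ≤ A) (h2 : ∫ p, U p ^ 2 ∂ν ≤ A) :
    (Measure.pi fun _ : Fin m => ν) {w | 3 * A * m < ∑ i, U (w i)} ≤ ENNReal.ofReal (A / m) := by
  set Q := Measure.pi fun _ : Fin m => ν
  have hmp : ∀ i : Fin m, MeasurePreserving (fun w : Fin m → S => w i) Q ν := fun i =>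
    measurePreserving_eval (fun _ : Fin m => ν) i
  have hUL : MemLp U 2 ν := (memLp_two_iff_integrable_sq hU.aestronglyMeasurable).2 hi2
  have hL : ∀ i : Fin m, MemLp (fun w : Fin m → S => U (w i)) 2 Q := fun i =>
    hUL.comp_measurePreserving (hmp i)
  have hind : iIndepFun (fun (i : Fin m) (w : Fin m → S) => U (w i)) Q :=
    iIndepFun_pi (X := fun _ p => U p) (fun _ => hU.aemeasurable)
  have hint : ∀ i : Fin m, ∫ w, U (w i) ∂Q = ∫ p, U p ∂ν := fun i => by
    conv_rhs => rw [← (hmp i).map_eq]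
    rw [integral_map (hmp i).measurable.aemeasurable hU.aestronglyMeasurable]
  have hvar : ∀ i : Fin m, variance (fun w : Fin m → S => U (w i)) Q ≤ A := fun i => by
    have h3 : variance (fun w : Fin m → S => U (w i)) Q = variance U ν := by
      conv_rhs => rw [← (hmp i).map_eq]
      rw [variance_map hU.aestronglyMeasurable.aemeasurable (hmp i).measurable.aemeasurable]
      rfl
    rw [h3]
    refine (variance_le_expectation_sq hU.aestronglyMeasurable).trans ?_
    simpa using h2
  have hvs : variance (∑ i, fun w : Fin m → S => U (w i)) Q ≤ m * A := by
    rw [IndepFun.variance_sum (fun i _ => hL i) (fun i _ j _ hij => hind.indepFun hij)]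
    refine (Finset.sum_le_sum fun i _ => hvar i).trans ?_
    simp
  have hm' : (0 : ℝ) < m := by exact_mod_cast hm
  have hmean : ∫ w, (∑ i, fun w : Fin m → S => U (w i)) w ∂Q ≤ m * A := by
    simp only [Finset.sum_apply]
    rw [integral_finsetSum _ fun i _ => (hL i).integrable (by norm_num)]
    simp only [hint, Finset.sum_const, Finset.card_univ, Fintype.card_fin, nsmul_eq_mul]
    gcongr
  -- The mean of the sum is at most Am, so exceeding 3Am means a deviation of at least m, as A ≥ 1.
  have hcheb := meas_ge_le_variance_div_sq (μ := Q)
    (memLp_finsetSum' Finset.univ fun i _ => hL i) hm'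
  refine (measure_mono ?_).trans (hcheb.trans (ENNReal.ofReal_le_ofReal ?_))
  · intro w hw
    simp only [Set.mem_ofPred_eq] at hw ⊢
    refine le_trans ?_ (le_abs_self _)
    rw [Finset.sum_apply]
    nlinarith
  · rw [div_le_div_iff₀ (by positivity) hm']
    nlinarith

end ProductTail

/-! ### Concentration of the sample matrix -/

section Concentration

/-- The regularity of a sample on which the entries of the sample matrix concentrate. -/
def IsRegularSample {E : Type*} {m n k : ℕ} (f : ℝ → E → ℝ) (x : EuclideanSpace ℝ (Fin n))
    (g : Fin k → Fin n) (A B : ℝ) (w : Fin m → (Fin n → ℝ) × E) : Prop :=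
  (∀ i, |measurement f x (w i).1 (w i).2| ≤ B) ∧
  ∑ i, measurement f x (w i).1 (w i).2 ^ 2 ≤ 3 * A * m ∧
  ∀ r : Fin k, ∑ i, measurement f x (w i).1 (w i).2 ^ 2 * (w i).1 (g r) ^ 4 ≤ 3 * A * m

variable {ζ : Measure ℝ} {K : ℝ≥0} {E : Type*} [MeasurableSpace E] {η : Measure E}
  [IsProbabilityMeasure η]
  {m n k : ℕ} {x : EuclideanSpace ℝ (Fin n)} {g : Fin k → Fin n} {c : Fin k → ℝ}
  {f : ℝ → E → ℝ}

/-- Markov's inequality for exp(|y|/L) handles each of the m measurements, and Chebyshev's each of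
the k + 1 sums. Coordinates outside the support need no condition, so n does not appear. -/
lemma measure_not_isRegularSample_le (h : IsCoordinateLaw ζ K)
    (hf : Measurable (Function.uncurry f))
    (hx : IsSignedSupport x g c) (hψ : psiNorm 1 (linkValue f k) (copiesLaw ζ η k) ≤ K)
    (hm : 0 < m) (B : ℝ) :
    (Measure.pi fun _ : Fin m => copiesLaw ζ η n)
        {w | ¬ IsRegularSample f x g (momentBound K) B w} ≤
      ENNReal.ofReal (m * (2 * Real.exp (-(B / ((K : ℝ) + 1)))) +
        (k + 1) * (momentBound K / m)) := by
  have := h.isProbabilityMeasure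
  have := isProbabilityMeasure_copiesLaw (ζ := ζ) (η := η) n
  set Q := Measure.pi fun _ : Fin m => copiesLaw ζ η n
  set A := momentBound K
  have hA : 1 ≤ A := one_le_momentBound K
  have hL : 0 < (K : ℝ) + 1 := by positivity
  have hy := measurable_measurement hf x
  have hsub : {w | ¬ IsRegularSample f x g A B w} ⊆
      (⋃ i : Fin m, {w | B < |measurement f x (w i).1 (w i).2|}) ∪
      ({w | 3 * A * m < ∑ i : Fin m, measurement f x (w i).1 (w i).2 ^ 2} ∪
      ⋃ r : Fin k, {w | 3 * A * m <
        ∑ i : Fin m, measurement f x (w i).1 (w i).2 ^ 2 * (w i).1 (g r) ^ 4}) := by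
    intro w hw
    by_contra hcon
    simp only [Set.mem_union, Set.mem_iUnion, Set.mem_ofPred_eq, not_or, not_exists, not_lt] at hcon
    exact hw ⟨hcon.1, hcon.2.1, hcon.2.2⟩
  have b1 : ∀ i : Fin m, Q {w | B < |measurement f x (w i).1 (w i).2|} ≤
      ENNReal.ofReal (2 * Real.exp (-(B / ((K : ℝ) + 1)))) := by
    intro i
    have hmp : MeasurePreserving (fun w : Fin m → (Fin n → ℝ) × E => w i) Q (copiesLaw ζ η n) :=
      measurePreserving_eval (fun _ : Fin m => copiesLaw ζ η n) i
    have hms : MeasurableSet {p : (Fin n → ℝ) × E | B < |measurement f x p.1 p.2|} :=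
      measurableSet_lt measurable_const hy.abs
    have e1 : Q {w | B < |measurement f x (w i).1 (w i).2|} =
        copiesLaw ζ η n {p | B < |measurement f x p.1 p.2|} :=
      hmp.measure_preimage hms.nullMeasurableSet
    rw [e1]
    set e := ENNReal.ofReal (Real.exp (B / ((K : ℝ) + 1))) with he
    have hmark := mul_meas_ge_le_lintegral₀ (μ := copiesLaw ζ η n)
      (f := fun p => ENNReal.ofReal (Real.exp (|measurement f x p.1 p.2| / ((K : ℝ) + 1))))
      (by fun_prop) e
    have hm2 := hmark.trans (lintegral_exp_measurement_le h hf hx hψ)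
    calc _ ≤ copiesLaw ζ η n {p : (Fin n → ℝ) × E | e ≤ ENNReal.ofReal
          (Real.exp (|measurement f x p.1 p.2| / ((K : ℝ) + 1)))} := by
          refine measure_mono fun p hp => ?_
          simp only [Set.mem_ofPred_eq] at hp ⊢
          refine ENNReal.ofReal_le_ofReal (Real.exp_le_exp.2 ?_)
          gcongr
      _ = ENNReal.ofReal (Real.exp (-(B / ((K : ℝ) + 1)))) * (e *
          copiesLaw ζ η n {p : (Fin n → ℝ) × E | e ≤ ENNReal.ofReal
          (Real.exp (|measurement f x p.1 p.2| / ((K : ℝ) + 1)))}) := by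
          rw [← mul_assoc, he, ← ofReal_exp_add]
          simp
      _ ≤ ENNReal.ofReal (Real.exp (-(B / ((K : ℝ) + 1)))) * 2 := by gcongr
      _ = _ := by
          rw [mul_comm, ENNReal.ofReal_mul (by norm_num)]
          simp
  have b2 : Q {w | 3 * A * m < ∑ i : Fin m, measurement f x (w i).1 (w i).2 ^ 2} ≤
      ENNReal.ofReal (A / m) := by
    obtain ⟨i1, i1'⟩ := measurement_moment h hf hx hψ (q := 2) (by norm_num)
    obtain ⟨i2, i2'⟩ := measurement_moment h hf hx hψ (q := 4) (by norm_num)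
    have e4 : ∀ y : ℝ, |y| ^ 4 = (y ^ 2) ^ 2 := fun y => by
      rw [← sq_abs y]; ring
    simp only [sq_abs] at i1 i1'
    simp only [e4] at i2 i2'
    exact pi_measure_sum_gt_le (hy.pow_const 2) hA hm i2 i1' i2'
  have b3 : ∀ r : Fin k, Q {w | 3 * A * m <
      ∑ i : Fin m, measurement f x (w i).1 (w i).2 ^ 2 * (w i).1 (g r) ^ 4} ≤
      ENNReal.ofReal (A / m) := by
    intro r
    obtain ⟨i1, i1'⟩ := sq_mul_pow_four_moment h hf hx hψ (g r) (Or.inl rfl)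
    obtain ⟨i2, i2'⟩ := sq_mul_pow_four_moment h hf hx hψ (g r) (Or.inr rfl)
    simp only [pow_one] at i1 i1'
    exact pi_measure_sum_gt_le
      (U := fun p : (Fin n → ℝ) × E => measurement f x p.1 p.2 ^ 2 * p.1 (g r) ^ 4)
      (by fun_prop) hA hm i2 i1' i2'
  have hpos : 0 ≤ A / m := by positivity
  calc _ ≤ _ := measure_mono hsub
    _ ≤ ∑ i : Fin m, Q {w | B < |measurement f x (w i).1 (w i).2|} + (ENNReal.ofReal (A / m) +
        ∑ r : Fin k, Q {w | 3 * A * m <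
          ∑ i : Fin m, measurement f x (w i).1 (w i).2 ^ 2 * (w i).1 (g r) ^ 4}) := by
        refine (measure_union_le _ _).trans (add_le_add (measure_iUnion_fintype_le _ _) ?_)
        exact (measure_union_le _ _).trans (add_le_add b2 (measure_iUnion_fintype_le _ _))
    _ ≤ ∑ _i : Fin m, ENNReal.ofReal (2 * Real.exp (-(B / ((K : ℝ) + 1)))) +
        (ENNReal.ofReal (A / m) + ∑ _r : Fin k, ENNReal.ofReal (A / m)) := by
        gcongr with i _ r _
        · exact b1 i
        · exact b3 r
    _ = _ := by
        simp only [Finset.sum_const, Finset.card_univ, Fintype.card_fin, nsmul_eq_mul]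
        rw [ENNReal.ofReal_add (by positivity) (by positivity), add_mul, one_mul,
          ENNReal.ofReal_add (by positivity) hpos, ENNReal.ofReal_mul (by positivity),
          ENNReal.ofReal_mul (p := (k : ℝ)) (by positivity), add_comm (ENNReal.ofReal (k : ℝ) * _)]
        simp

/-- The variance proxy of the entries of the sample matrix. -/
noncomputable def varianceProxy (K : ℝ≥0) : ℝ := 144 * ((K : ℝ) + 1) ^ 4 * momentBound K

/-- Every entry of the sample matrix is, on regular samples, a sum of independent terms that satisfy
a self-normalized exponential moment bound. -/
lemma exists_entry_control (h : IsCoordinateLaw ζ K) (hf : Measurable (Function.uncurry f))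
    (hx : IsSignedSupport x g c) (hψ : psiNorm 1 (linkValue f k) (copiesLaw ζ η k) ≤ K)
    {B lam : ℝ} (hB : 0 ≤ B) (hlam : lam * B * (2 * ((K : ℝ) + 1) ^ 2) ≤ 1) (j l : Fin n) :
    ∃ G H : (Fin n → ℝ) × E → ℝ, Measurable G ∧ Measurable H ∧
      (∀ t : ℝ, |t| = lam → ∫⁻ p, ENNReal.ofReal (Real.exp (t * G p - t ^ 2 * H p))
        ∂(copiesLaw ζ η n) ≤ 1) ∧
      ∀ w : Fin m → (Fin n → ℝ) × E, IsRegularSample f x g (momentBound K) B w →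
        ∑ i, G (w i) = ∑ i, measurement f x (w i).1 (w i).2 *
          ((w i).1 j * (w i).1 l - (1 : Matrix _ _ ℝ) j l) - m * crossCov f ζ η x j l ∧
        ∑ i, H (w i) ≤ varianceProxy K * m := by
  have hy := measurable_measurement hf x
  have hL1 : 1 ≤ (K : ℝ) + 1 := by linarith [K.2]
  have hA := one_le_momentBound K
  set L : ℝ := (K : ℝ) + 1
  set A := momentBound K
  have hmpos : (0 : ℝ) ≤ m := Nat.cast_nonneg m
  have hL2 : 1 ≤ L ^ 2 := one_le_pow₀ hL1
  have hL4 : L ^ 2 ≤ L ^ 4 := pow_le_pow_right₀ hL1 (by norm_num)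
  have hAm : 0 ≤ A * m := by positivity
  -- Stated for all indices so that it also serves the transposed entry, by symmetry.
  have mixed : ∀ j l : Fin n, j ∈ Set.range g → l ∉ Set.range g →
      ∃ G H : (Fin n → ℝ) × E → ℝ, Measurable G ∧ Measurable H ∧
      (∀ t : ℝ, |t| = lam → ∫⁻ p, ENNReal.ofReal (Real.exp (t * G p - t ^ 2 * H p))
        ∂(copiesLaw ζ η n) ≤ 1) ∧
      ∀ w : Fin m → (Fin n → ℝ) × E, IsRegularSample f x g A B w →
        ∑ i, G (w i) = ∑ i, measurement f x (w i).1 (w i).2 *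
          ((w i).1 j * (w i).1 l - (1 : Matrix _ _ ℝ) j l) - m * crossCov f ζ η x j l ∧
        ∑ i, H (w i) ≤ varianceProxy K * m := by
    intro j l hj hl
    refine ⟨_, _, ?_, ?_, fun t _ => lintegral_exp_mixed_le h hf hx hj hl t, ?_⟩
    · fun_prop
    · fun_prop
    · rintro w ⟨-, hw1, hw2⟩
      refine ⟨by rw [crossCov_comm, crossCov_eq_zero h hf hx hψ hl]; simp, ?_⟩
      obtain ⟨r, rfl⟩ := hj
      have h3 := hw2 r
      rw [← Finset.mul_sum]
      have h4 : ∑ i, measurement f x (w i).1 (w i).2 ^ 2 * (w i).1 (g r) ^ 2 ≤ 6 * A * m := by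
        calc _ ≤ ∑ i, (measurement f x (w i).1 (w i).2 ^ 2 +
              measurement f x (w i).1 (w i).2 ^ 2 * (w i).1 (g r) ^ 4) := by
              refine Finset.sum_le_sum fun i _ => ?_
              have : (w i).1 (g r) ^ 2 ≤ 1 + (w i).1 (g r) ^ 4 := by
                nlinarith [sq_nonneg ((w i).1 (g r) ^ 2 - 1), sq_nonneg ((w i).1 (g r))]
              nlinarith [mul_le_mul_of_nonneg_left this
                (sq_nonneg (measurement f x (w i).1 (w i).2))]
          _ ≤ _ := by rw [Finset.sum_add_distrib]; linarith
      calc L ^ 2 * _ ≤ L ^ 4 * (6 * A * m) := by gcongr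
        _ ≤ _ := by
          unfold varianceProxy
          have : 0 ≤ L ^ 4 * (A * m) := by positivity
          change _ ≤ 144 * L ^ 4 * A * m
          nlinarith
  by_cases hj : j ∈ Set.range g <;> by_cases hl : l ∈ Set.range g
  · refine ⟨_, _, ?_, ?_, fun t _ => lintegral_exp_inside_le h hf hx hψ j l t, ?_⟩
    · fun_prop
    · fun_prop
    · rintro w ⟨-, hw1, hw2⟩
      refine ⟨by rw [Finset.sum_sub_distrib]; simp, ?_⟩
      obtain ⟨r, rfl⟩ := hj
      obtain ⟨r', rfl⟩ := hl
      have h3 := hw2 r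
      have h4 := hw2 r'
      calc _ ≤ ∑ i, ((measurement f x (w i).1 (w i).2 ^ 2 * (w i).1 (g r) ^ 4 +
            measurement f x (w i).1 (w i).2 ^ 2 * (w i).1 (g r') ^ 4 +
            2 * measurement f x (w i).1 (w i).2 ^ 2) + 4 * A) := by
            refine Finset.sum_le_sum fun i _ => add_le_add_left ?_ _
            exact sq_measurement_mul_le _ _ _ _ (by rw [Matrix.one_apply]; split_ifs <;> simp)
        _ ≤ 16 * (A * m) := by
            simp only [Finset.sum_add_distrib, ← Finset.mul_sum, Finset.sum_const,
              Finset.card_univ, Fintype.card_fin, nsmul_eq_mul]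
            nlinarith
        _ ≤ 144 * L ^ 4 * A * m := by
            have : 1 * (A * m) ≤ L ^ 4 * (A * m) := by gcongr; linarith
            nlinarith
  · exact mixed j l hj hl
  · obtain ⟨G, H, hG, hH, h1, h2⟩ := mixed l j hl hj
    refine ⟨G, H, hG, hH, h1, fun w hw => ?_⟩
    obtain ⟨h3, h4⟩ := h2 w hw
    refine ⟨h3.trans ?_, h4⟩
    rw [crossCov_comm]
    congr 1
    refine Finset.sum_congr rfl fun i _ => ?_
    rw [mul_comm ((w i).1 l), Matrix.one_apply, Matrix.one_apply]
    simp only [eq_comm]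
  · refine ⟨_, _, ?_, ?_, fun t ht => lintegral_exp_outside_le h hf hx hj hl hB
      (by rw [ht]; exact hlam), ?_⟩
    · have := measurable_truncatedMeasurement (x := x) hf B
      fun_prop
    · have := measurable_truncatedMeasurement (x := x) hf B
      fun_prop
    · rintro w ⟨hw0, hw1, -⟩
      simp only [truncatedMeasurement, hw0, if_true]
      refine ⟨by rw [crossCov_eq_zero h hf hx hψ hj]; simp, ?_⟩
      rw [← Finset.mul_sum]
      calc 48 * L ^ 4 * _ ≤ 48 * L ^ 4 * (3 * A * m) := by gcongr
        _ = 144 * L ^ 4 * A * m := by ring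

lemma measure_entry_deviation_le (h : IsCoordinateLaw ζ K) (hf : Measurable (Function.uncurry f))
    (hx : IsSignedSupport x g c) (hψ : psiNorm 1 (linkValue f k) (copiesLaw ζ η k) ≤ K)
    {B lam : ℝ} (hB : 0 ≤ B) (hlam0 : 0 ≤ lam) (hlam : lam * B * (2 * ((K : ℝ) + 1) ^ 2) ≤ 1)
    (T : ℝ) (j l : Fin n) :
    (Measure.pi fun _ : Fin m => copiesLaw ζ η n)
        {w | IsRegularSample f x g (momentBound K) B w ∧
          T ≤ |∑ i, measurement f x (w i).1 (w i).2 *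
            ((w i).1 j * (w i).1 l - (1 : Matrix _ _ ℝ) j l) - m * crossCov f ζ η x j l|} ≤
      2 * ENNReal.ofReal (Real.exp (-(lam * T) + lam ^ 2 * (varianceProxy K * m))) := by
  have := h.isProbabilityMeasure
  have := isProbabilityMeasure_copiesLaw (ζ := ζ) (η := η) n
  obtain ⟨G, H, hG, hH, h1, h2⟩ := exists_entry_control (m := m) h hf hx hψ hB hlam j l
  refine (measure_mono ?_).trans
    (pi_measure_abs_sum_ge_le hG hH hlam0 h1 T (varianceProxy K * m))
  rintro w ⟨hw, hT⟩
  obtain ⟨h3, h4⟩ := h2 w hw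
  exact ⟨by rw [h3]; exact hT, h4⟩

end Concentration

/-! ### Recovery -/

lemma varianceProxy_ge (K : ℝ≥0) :
    144 * ((K : ℝ) + 1) ^ 4 ≤ varianceProxy K ∧ momentBound K ≤ varianceProxy K := by
  have hL1 : 1 ≤ (K : ℝ) + 1 := by linarith [K.2]
  have hL4 : 1 ≤ ((K : ℝ) + 1) ^ 4 := one_le_pow₀ hL1
  have hA := one_le_momentBound K
  unfold varianceProxy
  constructor <;> nlinarith

/-- The choice of the truncation level and of the exponent in the tail bounds. -/
lemma exists_exponent {L A V : ℝ} (hL1 : 1 ≤ L) (hA : 1 ≤ A) (hV1 : 144 * L ^ 4 ≤ V)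
    (hV2 : A ≤ V) {m n k s : ℕ} {μ ε δ : ℝ} (hμ : 0 < μ) (hε : 0 < ε)
    (hδ : 0 < δ) (hδ1 : δ < 1) (hn : 2 ≤ n) (hk : 0 < k) (hks : k ≤ s)
    (hm : 1024 * V * (s : ℝ) ^ 2 * (Real.log (n / δ) + Real.log (s / δ) ^ 4) /
        (μ ^ 2 * ε ^ 4) + 1024 * V * s / δ +
        1024 * V * Real.log (n / δ) * Real.log m ^ 2 ≤ (m : ℝ)) :
    0 < m ∧ ∃ B lam : ℝ, 0 ≤ B ∧ 0 ≤ lam ∧ lam * B * (2 * L ^ 2) ≤ 1 ∧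
      m * (2 * Real.exp (-(B / L))) + (k + 1) * (A / m) +
        n * (n * (2 * Real.exp (-(lam * (m * (μ * ε ^ 2 / (8 * s)))) +
          lam ^ 2 * (V * m)))) ≤ δ := by
  obtain ⟨Λ, hΛ⟩ : ∃ Λ, Λ = Real.log (n / δ) := ⟨_, rfl⟩
  obtain ⟨ℓ, hℓ⟩ : ∃ ℓ, ℓ = Real.log m := ⟨_, rfl⟩
  obtain ⟨t, ht⟩ : ∃ t, t = μ * ε ^ 2 / (8 * s) := ⟨_, rfl⟩
  rw [← hΛ, ← hℓ] at hm
  rw [← ht]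
  have hn' : (2 : ℝ) ≤ n := by exact_mod_cast hn
  have hs1 : (1 : ℝ) ≤ s := by exact_mod_cast (by omega : 1 ≤ s)
  have hks' : (k : ℝ) ≤ s := by exact_mod_cast hks
  have hL3 : 1 ≤ L ^ 3 := one_le_pow₀ hL1
  have hL34 : L ^ 3 ≤ L ^ 4 := pow_le_pow_right₀ hL1 (by norm_num)
  have hVpos : 0 < V := by linarith
  have hΛpos : 0 < Λ := hΛ ▸ Real.log_pos (by rw [lt_div_iff₀ hδ]; linarith)
  have t1 : 1024 * V * (s : ℝ) ^ 2 * Λ / (μ ^ 2 * ε ^ 4) ≤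
      1024 * V * (s : ℝ) ^ 2 * (Λ + Real.log (s / δ) ^ 4) / (μ ^ 2 * ε ^ 4) := by
    gcongr
    exact le_add_of_nonneg_right (by positivity)
  have t1' : 0 ≤ 1024 * V * (s : ℝ) ^ 2 * Λ / (μ ^ 2 * ε ^ 4) := by positivity
  have t2' : 0 ≤ 1024 * V * s / δ := by positivity
  have t3' : 0 ≤ 1024 * V * Λ * ℓ ^ 2 := by positivity
  have m1 : 1024 * V * (s : ℝ) ^ 2 * Λ / (μ ^ 2 * ε ^ 4) ≤ m := by linarith
  have m2 : 1024 * V * s / δ ≤ m := by linarith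
  have m3 : 1024 * V * Λ * ℓ ^ 2 ≤ m := by linarith
  rw [div_le_iff₀ hδ] at m2
  have hVs : V * 1 ≤ V * s := mul_le_mul_of_nonneg_left hs1 hVpos.le
  have hmδ : (m : ℝ) * δ ≤ m := mul_le_of_le_one_right (Nat.cast_nonneg m) hδ1.le
  have hm1 : (1 : ℝ) < m := by linarith
  have hmpos : (0 : ℝ) < m := by linarith
  refine ⟨by exact_mod_cast hmpos, ?_⟩
  have hlog : 0 < ℓ := hℓ ▸ Real.log_pos hm1
  have htpos : 0 < t := ht ▸ by positivity
  -- With t = με²/(8s) the first term of the sample size reads mt² ≥ 16VΛ. Multiplied by the third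
  -- term, it gives the lower bound on mt in `mtl`.
  have mt : 1024 * V * Λ ≤ 64 * (m * t ^ 2) := by
    rw [div_le_iff₀ (by positivity)] at m1
    have e : 64 * ((m : ℝ) * t ^ 2) = m * (μ ^ 2 * ε ^ 4) / (s : ℝ) ^ 2 := by
      rw [ht]; field_simp; ring
    rw [e, le_div_iff₀ (by positivity)]
    linarith
  have mtl : 1024 * V * Λ * ℓ ≤ 8 * (m * t) := by
    refine abs_le_of_sq_le_sq' ?_ (by positivity) |>.2
    calc (1024 * V * Λ * ℓ) ^ 2 = (1024 * V * Λ) * (1024 * V * Λ * ℓ ^ 2) := by ring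
      _ ≤ (64 * (m * t ^ 2)) * m := by gcongr
      _ = (8 * (m * t)) ^ 2 := by ring
  -- Makes exp(-B/L) = m⁻³, which survives the union over m measurements.
  obtain ⟨B, hB⟩ : ∃ B, B = 3 * L * ℓ := ⟨_, rfl⟩
  have hBpos : 0 < B := by rw [hB]; positivity
  -- The first value minimizes -λmt + λ²Vm; the second is the largest λ that the truncation allows.
  obtain ⟨lam, hlam⟩ : ∃ lam, lam = min (t / (2 * V)) (1 / (2 * L ^ 2 * B)) := ⟨_, rfl⟩
  have hlampos : 0 < lam := hlam ▸ lt_min (by positivity) (by positivity)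
  refine ⟨B, lam, hBpos.le, hlampos.le, ?_, ?_⟩
  · have : lam ≤ 1 / (2 * L ^ 2 * B) := hlam ▸ min_le_right _ _
    rw [le_div_iff₀ (by positivity)] at this
    linarith
  -- Half of the linear term absorbs the quadratic one. The target 4Λ produces (δ/n)⁴, enough for a
  -- union over n² entries.
  have hexp : 4 * Λ ≤ lam * (m * t) / 2 := by
    rcases min_choice (t / (2 * V)) (1 / (2 * L ^ 2 * B)) with hmin | hmin
    · have : t / (2 * V) * (m * t) / 2 = m * t ^ 2 / (4 * V) := by field_simp; ring
      rw [hlam, hmin, this, le_div_iff₀ (by positivity)]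
      linarith
    · have : 1 / (2 * L ^ 2 * B) * (m * t) / 2 = m * t / (12 * L ^ 3 * ℓ) := by
        rw [hB]; field_simp; ring
      rw [hlam, hmin, this, le_div_iff₀ (by positivity)]
      have h1 : 384 * L ^ 3 * (Λ * ℓ) ≤ 1024 * V * (Λ * ℓ) := by
        gcongr ?_ * _
        linarith
      linarith
  have hexp2 : -(lam * (m * t)) + lam ^ 2 * (V * m) ≤ -(4 * Λ) := by
    have h1 : lam ≤ t / (2 * V) := hlam ▸ min_le_left _ _
    rw [le_div_iff₀ (by positivity)] at h1
    have h2 : lam * m * (lam * (2 * V)) ≤ lam * m * t := by gcongr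
    linarith
  have hE : Real.exp (-(4 * Λ)) = (δ / n) ^ 4 := by
    have h1 : Real.exp Λ = n / δ := hΛ ▸ Real.exp_log (by positivity)
    rw [Real.exp_neg, ← inv_div, ← h1, inv_pow, ← Real.exp_nat_mul]
    norm_num
  have p1 : (m : ℝ) * (2 * Real.exp (-(B / L))) ≤ δ / 4 := by
    have h1 : B / L = (3 : ℕ) * ℓ := by rw [hB]; push_cast; field_simp
    have h2 : Real.exp (-(B / L)) = ((m : ℝ) ^ 3)⁻¹ := by
      rw [h1, Real.exp_neg, Real.exp_nat_mul, hℓ, Real.exp_log hmpos]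
    have e : (m : ℝ) * (2 * ((m : ℝ) ^ 3)⁻¹) = 2 / (m : ℝ) ^ 2 := by field_simp
    rw [h2, e, div_le_iff₀ (by positivity)]
    have h3 : 8 * 1 ≤ (m * δ) * m :=
      mul_le_mul (by linarith) hm1.le zero_le_one (by positivity)
    linarith
  have p2 : ((k : ℝ) + 1) * (A / m) ≤ δ / 4 := by
    rw [mul_div_assoc', div_le_iff₀ hmpos]
    have h1 : ((k : ℝ) + 1) * A ≤ (2 * s) * V := by
      gcongr
      linarith
    linarith
  have p3 : (n : ℝ) * (n * (2 * Real.exp (-(lam * (m * t)) + lam ^ 2 * (V * m)))) ≤ δ / 2 := by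
    calc _ ≤ (n : ℝ) * (n * (2 * (δ / n) ^ 4)) := by
          rw [← hE]
          gcongr
      _ = 2 * δ ^ 4 / (n : ℝ) ^ 2 := by field_simp
      _ ≤ 2 * δ / 4 := by
          have h4 : δ ^ 4 ≤ δ := pow_le_of_le_one hδ.le hδ1.le (by norm_num)
          have h5 : (4 : ℝ) ≤ (n : ℝ) ^ 2 := by nlinarith
          gcongr
      _ = δ / 2 := by ring
  linarith

lemma sampleMatrix_apply {m n : ℕ} (a : Fin m → Fin n → ℝ) (y : Fin m → ℝ) (j l : Fin n) :
    sampleMatrix a y j l =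
      (1 / (m : ℝ)) * ∑ i, y i * (a i j * a i l - (1 : Matrix _ _ ℝ) j l) := by
  simp [sampleMatrix, Matrix.sum_apply, Matrix.vecMulVec_apply]

lemma IsSample.map_eq {Ω E : Type*} [MeasurableSpace Ω] [MeasurableSpace E] {m n : ℕ}
    {a : Fin m → Ω → Fin n → ℝ} {ξ : Fin m → Ω → E} {ζ : Measure ℝ} {η : Measure E}
    {P : Measure Ω} [IsProbabilityMeasure P] (h : IsSample a ξ ζ η P) :
    P.map (fun ω i => (a i ω, ξ i ω)) = Measure.pi fun _ : Fin m => copiesLaw ζ η n := by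
  rw [(iIndepFun_iff_map_fun_eq_pi_map fun i => (h.law i).aemeasurable).1 h.indep]
  congr 1
  ext1 i
  exact (h.law i).map_eq

/-- The recovery guarantee, in terms of an enumeration of the support of the signal. -/
lemma measure_not_recovers_le {K : ℝ≥0} {Ω E : Type*} [MeasurableSpace Ω] [MeasurableSpace E]
    {P : Measure Ω} [IsProbabilityMeasure P] {η : Measure E} [IsProbabilityMeasure η]
    {ζ : Measure ℝ} {f : ℝ → E → ℝ} {m n k s : ℕ} {x : EuclideanSpace ℝ (Fin n)}
    {g : Fin k → Fin n} {c : Fin k → ℝ} {a : Fin m → Ω → Fin n → ℝ} {ξ : Fin m → Ω → E} {ε δ : ℝ}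
    (hζ : IsCoordinateLaw ζ K) (hf : Measurable (Function.uncurry f)) (hx1 : ‖x‖ = 1)
    (hx : IsSignedSupport x g c) (hks : k ≤ s) (hμ : 0 < muCov f ζ η k)
    (hσ : sigmaCov f ζ η k ≤ 0) (hψ : psiNorm 1 (linkValue f k) (copiesLaw ζ η k) ≤ K)
    (hsample : IsSample a ξ ζ η P) (hε : 0 < ε) (hδ : 0 < δ)
    (hm : 1024 * varianceProxy K * (s : ℝ) ^ 2 * (Real.log (n / δ) + Real.log (s / δ) ^ 4) /
        (muCov f ζ η k ^ 2 * ε ^ 4) + 1024 * varianceProxy K * s / δ +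
        1024 * varianceProxy K * Real.log (n / δ) * Real.log m ^ 2 ≤ (m : ℝ)) :
    P {ω | ¬ Recovers s (fun i => a i ω) (fun i => measurement f x (a i ω) (ξ i ω)) x ε} ≤
      ENNReal.ofReal δ := by
  have hs : (∑ j, |x j|) ^ 2 ≤ s := by
    rw [hx.sum_abs_sq]
    exact_mod_cast hks
  rcases le_or_gt 1 δ with hδ1 | hδ1
  · exact prob_le_one.trans (ENNReal.one_le_ofReal.2 hδ1)
  rcases Nat.lt_or_ge n 2 with hn | hn
  · have hn1 : n = 1 := by
      have := hx.le_dim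
      have := hx.pos
      omega
    subst hn1
    have : {ω | ¬ Recovers s (fun i => a i ω)
        (fun i => measurement f x (a i ω) (ξ i ω)) x ε} = ∅ :=
      Set.eq_empty_of_forall_notMem fun ω hω =>
        hω (recovers_of_dim_one hx1 hs hε)
    simp [this]
  obtain ⟨hmpos, B, lam, hB, hlam0, hlam, hbound⟩ :=
    exists_exponent (by linarith [K.2] : 1 ≤ (K : ℝ) + 1) (one_le_momentBound K)
      (varianceProxy_ge K).1 (varianceProxy_ge K).2 hμ hε hδ hδ1 hn hx.pos hks hm
  set μ := muCov f ζ η k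
  set T : ℝ := m * (μ * ε ^ 2 / (8 * s)) with hT
  set M := crossCov f ζ η x
  have hm' : (0 : ℝ) < m := by exact_mod_cast hmpos
  have hs' : (0 : ℝ) < s := by
    have := hx.pos
    exact_mod_cast (by omega : 0 < s)
  set Q := Measure.pi fun _ : Fin m => copiesLaw ζ η n
  set R : Set (Fin m → (Fin n → ℝ) × E) :=
    {w | ¬ IsRegularSample f x g (momentBound K) B w}
  set D : Fin n → Fin n → Set (Fin m → (Fin n → ℝ) × E) := fun j l =>
    {w | IsRegularSample f x g (momentBound K) B w ∧
      T ≤ |∑ i, measurement f x (w i).1 (w i).2 *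
        ((w i).1 j * (w i).1 l - (1 : Matrix _ _ ℝ) j l) - m * M j l|}
  obtain ⟨hM, hMx⟩ := crossCov_quadraticForm hζ hf hx1 hx hψ hσ
  have hsub : {ω | ¬ Recovers s (fun i => a i ω)
      (fun i => measurement f x (a i ω) (ξ i ω)) x ε} ⊆
      (fun ω i => (a i ω, ξ i ω)) ⁻¹' (R ∪ ⋃ j, ⋃ l, D j l) := by
    intro ω hω
    by_contra hcon
    simp only [Set.mem_preimage, Set.mem_union, Set.mem_iUnion, not_or, not_exists] at hcon
    obtain ⟨h1, h2⟩ := hcon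
    have hreg : IsRegularSample f x g (momentBound K) B
      (fun i => (a i ω, ξ i ω)) := not_not.1 h1
    refine hω (recovers_of_entrywise_close hx1 hs hμ hε
      (fun X hX => hM X hX.1) hMx fun j l => ?_)
    have h3 : |∑ i, measurement f x (a i ω) (ξ i ω) *
        (a i ω j * a i ω l - (1 : Matrix _ _ ℝ) j l) - m * M j l| < T :=
      not_le.1 fun hle => h2 j l ⟨hreg, hle⟩
    rw [sampleMatrix_apply]
    set Sm := ∑ i, measurement f x (a i ω) (ξ i ω) *
        (a i ω j * a i ω l - (1 : Matrix _ _ ℝ) j l)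
    have e : 1 / (m : ℝ) * Sm - M j l = (Sm - m * M j l) / m := by field_simp
    rw [e, abs_div, abs_of_pos hm', div_mul_eq_mul_div, div_le_iff₀ hm']
    calc |Sm - m * M j l| * (8 * s) ≤ T * (8 * s) := by gcongr
      _ = μ * ε ^ 2 * m := by rw [hT]; field_simp
  set e := Real.exp (-(lam * T) + lam ^ 2 * (varianceProxy K * m))
  have hDle : ∀ j l, Q (D j l) ≤ 2 * ENNReal.ofReal e := fun j l =>
    measure_entry_deviation_le hζ hf hx hψ hB hlam0 hlam T j l
  have hRle := measure_not_isRegularSample_le hζ hf hx hψ hmpos B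
  have hA := one_le_momentBound K
  calc _ ≤ P ((fun ω i => (a i ω, ξ i ω)) ⁻¹' (R ∪ ⋃ j, ⋃ l, D j l)) := measure_mono hsub
    _ ≤ (P.map fun ω i => (a i ω, ξ i ω)) (R ∪ ⋃ j, ⋃ l, D j l) :=
        -- This inequality holds for arbitrary sets, so the bad event need not be measurable.
        Measure.le_map_apply
          (aemeasurable_pi_lambda _ fun i => (hsample.law i).aemeasurable) _
    _ = Q (R ∪ ⋃ j, ⋃ l, D j l) := by rw [hsample.map_eq]
    _ ≤ Q R + ∑ j, ∑ l, Q (D j l) := by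
        refine (measure_union_le _ _).trans (add_le_add_right ?_ _)
        refine (measure_iUnion_fintype_le _ _).trans (Finset.sum_le_sum fun j _ => ?_)
        exact measure_iUnion_fintype_le _ _
    _ ≤ ENNReal.ofReal (m * (2 * Real.exp (-(B / ((K : ℝ) + 1)))) +
          (k + 1) * (momentBound K / m)) +
        ∑ _j : Fin n, ∑ _l : Fin n, 2 * ENNReal.ofReal e := by
        gcongr with j _ l _
        exact hDle j l
    _ = ENNReal.ofReal (m * (2 * Real.exp (-(B / ((K : ℝ) + 1)))) +
          (k + 1) * (momentBound K / m) + n * (n * (2 * e))) := by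
        have he : 0 ≤ e := (Real.exp_pos _).le
        rw [ENNReal.ofReal_add (p := _ + _) (by positivity) (by positivity),
          ENNReal.ofReal_mul (p := (n : ℝ)) (by positivity),
          ENNReal.ofReal_mul (p := (n : ℝ)) (by positivity),
          ENNReal.ofReal_mul (p := (2 : ℝ)) (by positivity)]
        simp
    _ ≤ ENNReal.ofReal δ := ENNReal.ofReal_le_ofReal hbound

end SparsePR

theorem theorem2 (K : ℝ≥0) :
    ∃ C : ℝ, 0 < C ∧
      ∀ {Ω E : Type*} [MeasurableSpace Ω] [MeasurableSpace E]
        (P : Measure Ω) [IsProbabilityMeasure P] (η : Measure E) [IsProbabilityMeasure η]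
        (ζ : Measure ℝ) (f : ℝ → E → ℝ) (m n s : ℕ) (x : EuclideanSpace ℝ (Fin n))
        (a : Fin m → Ω → Fin n → ℝ) (ξ : Fin m → Ω → E) (ε δ : ℝ),
        SparsePR.IsCoordinateLaw ζ K →
        Measurable (Function.uncurry f) →
        SparsePR.IsAdmissible s x →
        0 < SparsePR.muCov f ζ η (SparsePR.supportSize x) →
        SparsePR.sigmaCov f ζ η (SparsePR.supportSize x) ≤ 0 →
        SparsePR.psiNorm 1 (SparsePR.linkValue f (SparsePR.supportSize x))
          (SparsePR.copiesLaw ζ η (SparsePR.supportSize x)) ≤ K →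
        SparsePR.IsSample a ξ ζ η P →
        0 < ε → 0 < δ →
        C * (s : ℝ) ^ 2 * (Real.log (n / δ) + Real.log (s / δ) ^ 4) /
              (SparsePR.muCov f ζ η (SparsePR.supportSize x) ^ 2 * ε ^ 4)
            + C * s / δ + C * Real.log (n / δ) * Real.log m ^ 2 ≤ (m : ℝ) →
        P {ω | ¬ SparsePR.Recovers s (fun i => a i ω)
              (fun i => SparsePR.measurement f x (a i ω) (ξ i ω)) x ε} ≤ ENNReal.ofReal δ := by
  -- 1024 = 16 · 64: the 64 is the squared 8 in the tolerance με²/(8s), and the 16 comes from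
  -- requiring mt²/(4V) ≥ 4 log(n/δ).
  refine ⟨1024 * SparsePR.varianceProxy K, ?_, ?_⟩
  · have h1 := SparsePR.one_le_momentBound K
    have h2 := (SparsePR.varianceProxy_ge K).2
    linarith
  · intro Ω E _ _ P _ η _ ζ f m n s x a ξ ε δ hζ hf hadm hμ hσ hψ hsample hε hδ hm
    obtain ⟨hks, g, c, hx⟩ := hadm.exists_isSignedSupport
    exact SparsePR.measure_not_recovers_le hζ hf hadm.1 hx hks hμ hσ hψ hsample hε hδ hm
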